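/- **Conventions.** Vocabularies are many-sorted, with finitary relation, function and constant symbols; all sorts of a structure are nonempty, and the cardinality of a structure is its total number of elements. A *logic* $\mathcal L$ assigns to each vocabulary $\tau$ a collection $\mathcal L[\tau]$ of sentences, with a satisfaction relation $\models_{\mathcal L}$ between $\tau$-structures and sentences that is invariant under isomorphism and has the inclusion, reduct and renaming properties (if $\rho$ renames $\sigma$ injectively into $\tau$, each $\varphi\in\mathcal L[\sigma]$ has a counterpart in $\mathcal L[\tau]$ that holds in $\mathfrak A$ iff $\varphi$ holds in the $\rho$-reduct of $\mathfrak A$). $\mathcal L$ is *regular* if it contains the atomic sentences of first-order logic and is closed (up to equivalence) under negation, conjunction, existential quantification over a constant, relativization (to nonempty subsets of the sorts, closed under constants and functions), and substitution (simultaneous replacement of relation, function and constant symbols by $\mathcal L$-definitions). $\mathfrak B$ is an *$\mathcal L$-elementary extension* of $\mathfrak A$ if, up to isomorphism, $\mathfrak A\subseteq\mathfrak B$ and $(\mathfrak A,a)_{a\in A}$, $(\mathfrak B,a)_{a\in A}$ satisfy the same $\mathcal L$-sentences. For a cardinal $\kappa$, let $S_\kappa(\kappa)$ be the set of subsets of $\kappa$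 of cardinality $<\kappa$; $X\subseteq S_\kappa(\kappa)$ is *cofinal* if each $x\in S_\kappa(\kappa)$ is contained in some $y\in X$. Let $\lambda\ge\mu$ be infinite cardinals, let $V_0$ and $V$ be cofinal in $S_\lambda(\lambda)$, and let $W$ be cofinal in $S_\mu(\mu)$. Let $\mathfrak A'=\langle\lambda,R,R_v\rangle_{v\in V\cup W}$, where $R(\gamma)$ iff $\gamma<\mu$, and $R_v(\gamma)$ iff $\gamma\in v$. $\mathcal L$ is *$[\lambda]$-compact* if, for every set $\Sigma$ of $\mathcal L$-sentences and all $\mathcal L$-sentences $(\varphi_v)_{v\in V_0}$ (of the same vocabulary), if $\Sigma\cup\{\varphi_v\mid v\in V_0,\ \gamma\notin v\}$ has a model for every $\gamma\in\lambda$, then $\Sigma\cup\{\varphi_v\mid v\in V_0\}$ has a model. A *limit ultrafilter* $(D,\mathcal V)$ is an ultrafilter $D$ over a set $I$ together with a filter $\mathcal V$ over $I\times I$. The corresponding limit ultrapower of $\mathfrak A$ is the substructure of the ultrapower $\prod_D\mathfrak A$ whose elements are the classes $f/D$ of functions $f$ with $\{(i,j)\mid f(i)=f(j)\}\in\mathcal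 V$. $(D,\mathcal V)$ is *$\lambda$-decomposable* if there is $f:I\to\lambda$ such that $\{(i,j)\mid f(i)=f(j)\}\in\mathcal V$ and $f^{-1}(v)\notin D$ for every $v\subseteq\lambda$ with $|v|<\lambda$. $\mathbf F(\mathcal L)$ is the class of all $(D,\mathcal V,\nu)$ such that, for every structure $\mathfrak A$ of cardinality $\le\nu$, the limit ultrapower of $\mathfrak A$ by $(D,\mathcal V)$ is an $\mathcal L$-elementary extension of $\mathfrak A$ via the diagonal embedding. **Proposition.** Let $\mathcal L$ be a regular logic, and let $\lambda,\mu,V_0,V,W$ be as above. The following are equivalent. (a) $\mathcal L$ is $[\lambda]$-compact. (b) Every many-sorted expansion $\mathfrak A$ of $\mathfrak A'$ (that is, $\mathfrak A$ has a larger vocabulary, possibly with new sorts, and its reduct to the vocabulary of $\mathfrak A'$ is $\mathfrak A'$) has an $\mathcal L$-elementary extension $\mathfrak B$ with an element $x$, of the sort of $\lambda$, such that $\mathfrak B\models\neg R_v(x)$ for every $v\in V$. (c) For every infinite cardinal $\nu$ there is a $\lambda$-decomposable limit ultrafilter $(D,\mathcal V)$ such that $(D,\mathcal V,\nu)\in\mathbf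 F(\mathcal L)$. In particular, none of the conditions depends on the choice of $V_0$, $\mu$, $V$, $W$. -/

import Mathlib

open Cardinal

universe u v

noncomputable section

namespace ManySorted

/-! ## Many-sorted vocabularies and structures -/

/-- Finitary relation, function and constant symbols over a set `S` of sorts, classified by
the sorts of their arguments (and of their values). -/
structure Signature (S : Type u) : Type (u + 1) where
  Rel : {n : ℕ} → (Fin n → S) → Type u
  Func : {n : ℕ} → (Fin n → S) → S → Type u
  Const : S → Type u

/-- A many-sorted vocabulary. -/
structure Vocab : Type (u + 1) where
  Srt : Type u
  sig : Signature.{u} Srt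

/-- Disjoint union of two sets of symbols over the same sorts. -/
def Signature.sum {S : Type u} (E F : Signature.{u} S) : Signature.{u} S where
  Rel s := E.Rel s ⊕ F.Rel s
  Func s t := E.Func s t ⊕ F.Func s t
  Const t := E.Const t ⊕ F.Const t

/-- The vocabulary `τ ∪ E`, where `E` is a set of new symbols over the sorts of `τ`. -/
def Vocab.extend (τ : Vocab.{u}) (E : Signature.{u} τ.Srt) : Vocab.{u} where
  Srt := τ.Srt
  sig := τ.sig.sum E

/-- An interpretation of the symbols of `E` on a family of domains `M`. -/
structure Interp {S : Type u} (E : Signature.{u} S) (M : S → Type u) : Type u where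
  rel : {n : ℕ} → {s : Fin n → S} → E.Rel s → (∀ i, M (s i)) → Prop
  func : {n : ℕ} → {s : Fin n → S} → {t : S} → E.Func s t → (∀ i, M (s i)) → M t
  const : {t : S} → E.Const t → M t

/-- Interpretations of `E` and of `F` together interpret their disjoint union. -/
def Interp.sum {S : Type u} {E F : Signature.{u} S} {M : S → Type u}
    (a : Interp E M) (b : Interp F M) : Interp (E.sum F) M where
  rel r x := Sum.elim (fun r => a.rel r x) (fun r => b.rel r x) r
  func f x := Sum.elim (fun f => a.func f x) (fun f => b.func f x) f
  const c := Sum.elim (fun c => a.const c) (fun c => b.const c) c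

/-- A many-sorted structure (all domains are nonempty). -/
structure Str (τ : Vocab.{u}) : Type (u + 1) where
  carrier : τ.Srt → Type u
  nonempty : ∀ s, Nonempty (carrier s)
  interp : Interp τ.sig carrier

/-- The cardinality of a many-sorted structure: the total number of its elements. -/
def Str.card {τ : Vocab.{u}} (A : Str τ) : Cardinal.{u} := #(Σ s, A.carrier s)

/-- The expansion of `A` by an interpretation of the new symbols. -/
def Str.expand {τ : Vocab.{u}} (A : Str τ) {E : Signature.{u} τ.Srt} (J : Interp E A.carrier) :
    Str (τ.extend E) where
  carrier := A.carrier
  nonempty := A.nonempty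
  interp := A.interp.sum J

/-- Isomorphisms of many-sorted structures. -/
structure Iso {τ : Vocab.{u}} (A B : Str τ) : Type u where
  equiv : ∀ s, A.carrier s ≃ B.carrier s
  map_rel : ∀ {n : ℕ} {s : Fin n → τ.Srt} (r : τ.sig.Rel s) (x : ∀ i, A.carrier (s i)),
    A.interp.rel r x ↔ B.interp.rel r (fun i => equiv (s i) (x i))
  map_func : ∀ {n : ℕ} {s : Fin n → τ.Srt} {t : τ.Srt} (f : τ.sig.Func s t)
    (x : ∀ i, A.carrier (s i)),
    equiv t (A.interp.func f x) = B.interp.func f (fun i => equiv (s i) (x i))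
  map_const : ∀ {t : τ.Srt} (c : τ.sig.Const t), equiv t (A.interp.const c) = B.interp.const c

/-- Maps of vocabularies, respecting sorts and kinds of symbols. -/
structure VocabHom (σ τ : Vocab.{u}) : Type u where
  srt : σ.Srt → τ.Srt
  rel : {n : ℕ} → {s : Fin n → σ.Srt} → σ.sig.Rel s → τ.sig.Rel (fun i => srt (s i))
  func : {n : ℕ} → {s : Fin n → σ.Srt} → {t : σ.Srt} → σ.sig.Func s t →
    τ.sig.Func (fun i => srt (s i)) (srt t)
  const : {t : σ.Srt} → σ.sig.Const t → τ.sig.Const (srt t)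

/-- An injective map of vocabularies is a renaming of `σ` onto a subvocabulary of `τ`. -/
structure VocabHom.IsInjective {σ τ : Vocab.{u}} (ρ : VocabHom σ τ) : Prop where
  srt : Function.Injective ρ.srt
  rel : ∀ {n : ℕ} {s : Fin n → σ.Srt}, Function.Injective (fun r : σ.sig.Rel s => ρ.rel r)
  func : ∀ {n : ℕ} {s : Fin n → σ.Srt} {t : σ.Srt},
    Function.Injective (fun f : σ.sig.Func s t => ρ.func f)
  const : ∀ {t : σ.Srt}, Function.Injective (fun c : σ.sig.Const t => ρ.const c)

/-- The (renamed) reduct of a `τ`-structure to `σ`. -/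
def Str.reduct {σ τ : Vocab.{u}} (A : Str τ) (ρ : VocabHom σ τ) : Str σ where
  carrier s := A.carrier (ρ.srt s)
  nonempty s := A.nonempty (ρ.srt s)
  interp :=
    { rel := fun r x => A.interp.rel (ρ.rel r) x
      func := fun f x => A.interp.func (ρ.func f) x
      const := fun c => A.interp.const (ρ.const c) }

/-! ### Special sets of new symbols -/

/-- A set of new constants: `C t` is the set of new constants of sort `t`. -/
def constSig {S : Type u} (C : S → Type u) : Signature.{u} S where
  Rel _ := PEmpty
  Func _ _ := PEmpty
  Const := C

def constInterp {S : Type u} {C M : S → Type u} (h : ∀ t, C t → M t) :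
    Interp (constSig C) M where
  rel r := nomatch r
  func f := nomatch f
  const c := h _ c

/-- The new constants `c_i` (`i : ι`), where `c_i` is of sort `s i`. -/
def tupleSig {S : Type u} {ι : Type} (s : ι → S) : Signature.{u} S :=
  constSig fun t => ULift.{u} {i : ι // s i = t}

/-- The interpretation of each `c_i` by `x i`. -/
def tupleInterp {S : Type u} {ι : Type} {s : ι → S} {M : S → Type u} (x : ∀ i, M (s i)) :
    Interp (tupleSig s) M :=
  constInterp fun _ c => c.down.2 ▸ x c.down.1

/-- The expansion `(A, x_i)_i` of `A` by constants for a tuple of elements. -/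
def Str.withTuple {τ : Vocab.{u}} (A : Str τ) {ι : Type} {s : ι → τ.Srt}
    (x : ∀ i, A.carrier (s i)) : Str (τ.extend (tupleSig s)) :=
  A.expand (tupleInterp x)

/-- One unary relation symbol for each sort. -/
inductive UnaryRel (S : Type u) : {n : ℕ} → (Fin n → S) → Type u
  | on (t : S) : UnaryRel S (fun _ : Fin 1 => t)

/-- One new unary relation symbol for each sort. -/
def unarySig (S : Type u) : Signature.{u} S where
  Rel s := UnaryRel S s
  Func _ _ := PEmpty
  Const _ := PEmpty

def unaryInterp {S : Type u} {M : S → Type u} (U : ∀ t, Set (M t)) :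
    Interp (unarySig S) M where
  rel r := match r with
    | UnaryRel.on t => fun x => x 0 ∈ U t
  func f := nomatch f
  const c := nomatch c

/-- `U` is a family of nonempty subsets of the domains of `A`, closed under the constants and
the functions of `A`. -/
structure Str.IsClosed {τ : Vocab.{u}} (A : Str τ) (U : ∀ t, Set (A.carrier t)) : Prop where
  nonempty : ∀ t, (U t).Nonempty
  func : ∀ {n : ℕ} {s : Fin n → τ.Srt} {t : τ.Srt} (f : τ.sig.Func s t)
    (x : ∀ i, A.carrier (s i)), (∀ i, x i ∈ U (s i)) → A.interp.func f x ∈ U t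
  const : ∀ {t : τ.Srt} (c : τ.sig.Const t), A.interp.const c ∈ U t

/-- The substructure of `A` on a closed family of subsets. -/
def Str.restrict {τ : Vocab.{u}} (A : Str τ) (U : ∀ t, Set (A.carrier t))
    (hU : A.IsClosed U) : Str τ where
  carrier t := ↥(U t)
  nonempty t := (hU.nonempty t).to_subtype
  interp :=
    { rel := fun r x => A.interp.rel r (fun i => (x i).1)
      func := fun f x => ⟨A.interp.func f (fun i => (x i).1), hU.func f _ (fun i => (x i).2)⟩
      const := fun c => ⟨A.interp.const c, hU.const c⟩ }

/-! ### Atomic sentences of first-order logic -/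

/-- Closed terms. -/
inductive ClosedTerm (τ : Vocab.{u}) : τ.Srt → Type u
  | const {t : τ.Srt} (c : τ.sig.Const t) : ClosedTerm τ t
  | app {n : ℕ} {s : Fin n → τ.Srt} {t : τ.Srt} (f : τ.sig.Func s t)
      (args : ∀ i, ClosedTerm τ (s i)) : ClosedTerm τ t

def ClosedTerm.eval {τ : Vocab.{u}} (A : Str τ) : {t : τ.Srt} → ClosedTerm τ t → A.carrier t
  | _, .const c => A.interp.const c
  | _, .app f args => A.interp.func f (fun i => (args i).eval A)

inductive AtomicSentence (τ : Vocab.{u}) : Type u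
  | eq {t : τ.Srt} (a b : ClosedTerm τ t) : AtomicSentence τ
  | rel {n : ℕ} {s : Fin n → τ.Srt} (r : τ.sig.Rel s) (args : ∀ i, ClosedTerm τ (s i)) :
      AtomicSentence τ

def AtomicSentence.Holds {τ : Vocab.{u}} (A : Str τ) : AtomicSentence τ → Prop
  | .eq a b => a.eval A = b.eval A
  | .rel r args => A.interp.rel r (fun i => (args i).eval A)

/-! ## Abstract logics -/

/-- An abstract logic: sentences of each vocabulary and a satisfaction relation, with the
isomorphism property and the inclusion, reduct and renaming properties. The last three are
stated together, for renamings of a vocabulary `σ` onto a part of a vocabulary `τ`. -/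
structure AbstractLogic where
  Sentence : Vocab.{u} → Type v
  Sat : {τ : Vocab.{u}} → Str τ → Sentence τ → Prop
  sat_iso : ∀ {τ : Vocab.{u}} (A B : Str τ), Iso A B → ∀ φ : Sentence τ, Sat A φ ↔ Sat B φ
  exists_rename : ∀ {σ τ : Vocab.{u}} (ρ : VocabHom σ τ), ρ.IsInjective → ∀ φ : Sentence σ,
    ∃ ψ : Sentence τ, ∀ A : Str τ, Sat A ψ ↔ Sat (A.reduct ρ) φ

namespace AbstractLogic

variable (L : AbstractLogic.{u, v})

/-- Definitions, by sentences of `L` in the vocabulary `τ` with extra constants for the arguments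
(and the value), of a set `E` of new relation, function and constant symbols. -/
structure Definitions (τ : Vocab.{u}) (E : Signature.{u} τ.Srt) where
  rel : {n : ℕ} → {s : Fin n → τ.Srt} → E.Rel s → L.Sentence (τ.extend (tupleSig s))
  func : {n : ℕ} → {s : Fin n → τ.Srt} → {t : τ.Srt} → E.Func s t →
    L.Sentence (τ.extend (tupleSig (fun o : Option (Fin n) => o.elim t s)))
  const : {t : τ.Srt} → E.Const t → L.Sentence (τ.extend (tupleSig (fun _ : Unit => t)))

/-- The tuple consisting of `y` and the `x i`. -/
def optionTuple {S : Type u} {M : S → Type u} {n : ℕ} {s : Fin n → S} {t : S}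
    (x : ∀ i, M (s i)) (y : M t) : ∀ o : Option (Fin n), M (o.elim t s)
  | none => y
  | some i => x i

/-- In `A`, the interpretation `J` of the new symbols is the one given by the definitions. -/
structure Definitions.DefinesIn {L : AbstractLogic.{u, v}} {τ : Vocab.{u}}
    {E : Signature.{u} τ.Srt} (δ : L.Definitions τ E) (A : Str τ) (J : Interp E A.carrier) :
    Prop where
  rel : ∀ {n : ℕ} {s : Fin n → τ.Srt} (r : E.Rel s) (x : ∀ i, A.carrier (s i)),
    J.rel r x ↔ L.Sat (A.withTuple x) (δ.rel r)
  func : ∀ {n : ℕ} {s : Fin n → τ.Srt} {t : τ.Srt} (f : E.Func s t)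
    (x : ∀ i, A.carrier (s i)) (y : A.carrier t),
    J.func f x = y ↔ L.Sat (A.withTuple (optionTuple x y)) (δ.func f)
  const : ∀ {t : τ.Srt} (c : E.Const t) (y : A.carrier t),
    J.const c = y ↔ L.Sat (A.withTuple (s := fun _ : Unit => t) (fun _ => y)) (δ.const c)

/-- Regular logics: closure under atomic sentences, negation, conjunction, particularization,
relativization and substitution. -/
structure IsRegular : Prop where
  atom : ∀ {τ : Vocab.{u}} (α : AtomicSentence τ),
    ∃ ψ : L.Sentence τ, ∀ A : Str τ, L.Sat A ψ ↔ α.Holds A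
  neg : ∀ {τ : Vocab.{u}} (φ : L.Sentence τ),
    ∃ ψ : L.Sentence τ, ∀ A : Str τ, L.Sat A ψ ↔ ¬ L.Sat A φ
  conj : ∀ {τ : Vocab.{u}} (φ₁ φ₂ : L.Sentence τ),
    ∃ ψ : L.Sentence τ, ∀ A : Str τ, L.Sat A ψ ↔ (L.Sat A φ₁ ∧ L.Sat A φ₂)
  particularization : ∀ {τ : Vocab.{u}} (t : τ.Srt)
    (φ : L.Sentence (τ.extend (tupleSig (fun _ : Unit => t)))),
    ∃ ψ : L.Sentence τ, ∀ A : Str τ,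
      L.Sat A ψ ↔ ∃ a : A.carrier t, L.Sat (A.withTuple (s := fun _ : Unit => t) (fun _ => a)) φ
  relativization : ∀ {τ : Vocab.{u}} (φ : L.Sentence τ),
    ∃ ψ : L.Sentence (τ.extend (unarySig τ.Srt)),
      ∀ (A : Str τ) (U : ∀ t, Set (A.carrier t)) (hU : A.IsClosed U),
        L.Sat (A.expand (unaryInterp U)) ψ ↔ L.Sat (A.restrict U hU) φ
  substitution : ∀ {τ : Vocab.{u}} {E : Signature.{u} τ.Srt} (δ : L.Definitions τ E)
    (φ : L.Sentence (τ.extend E)),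
    ∃ ψ : L.Sentence τ, ∀ (A : Str τ) (J : Interp E A.carrier), δ.DefinesIn A J →
      (L.Sat A ψ ↔ L.Sat (A.expand J) φ)

/-- `h : A → B` is `L`-elementary: `(A, a)_{a ∈ A}` and `(B, h a)_{a ∈ A}` satisfy the same
sentences of `L`. Thus, up to isomorphism, `B` is an `L`-elementary extension of `A`. -/
def IsElementary {τ : Vocab.{u}} (A B : Str τ) (h : ∀ s, A.carrier s → B.carrier s) : Prop :=
  ∀ φ : L.Sentence (τ.extend (constSig A.carrier)),
    L.Sat (A.expand (constInterp fun _ a => a)) φ ↔ L.Sat (B.expand (constInterp h)) φ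

/-- The set `T` of sentences has a model. -/
def HasModel {τ : Vocab.{u}} (T : Set (L.Sentence τ)) : Prop :=
  ∃ A : Str τ, ∀ φ ∈ T, L.Sat A φ

end AbstractLogic

/-! ## Cofinal families and `[lam]`-compactness -/

/-- The underlying set of (the initial ordinal) `lam`. -/
abbrev Base (lam : Cardinal.{u}) : Type u := lam.ord.ToType

theorem nonempty_base {lam : Cardinal.{u}} (h : ℵ₀ ≤ lam) : Nonempty (Base lam) := by
  rw [← Cardinal.mk_ne_zero_iff, Cardinal.mk_ord_toType]
  exact (Cardinal.aleph0_pos.trans_le h).ne'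

/-- `V` is a cofinal subset of the set of all subsets of `X` of cardinality `< kap`. -/
def IsCofinalFamily {Y : Type u} (X : Set Y) (kap : Cardinal.{u}) (V : Set (Set Y)) : Prop :=
  (∀ v ∈ V, v ⊆ X ∧ #v < kap) ∧ ∀ x : Set Y, x ⊆ X → #x < kap → ∃ v ∈ V, x ⊆ v

/-- The ordinals `< mu`, inside `lam`. -/
def below (lam mu : Cardinal.{u}) : Set (Base lam) :=
  {γ | (Ordinal.ToType.toOrd γ).1 < mu.ord}

/-- `[lam]`-compactness, relative to a cofinal family `V` of subsets of `lam` of cardinality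
`< lam`. -/
def AbstractLogic.IsCompactRelTo (L : AbstractLogic.{u, v}) (lam : Cardinal.{u})
    (V : Set (Set (Base lam))) : Prop :=
  ∀ (τ : Vocab.{u}) (S : Set (L.Sentence τ)) (φ : V → L.Sentence τ),
    (∀ γ : Base lam, L.HasModel (S ∪ {ψ | ∃ v : V, γ ∉ v.1 ∧ φ v = ψ})) →
      L.HasModel (S ∪ Set.range φ)

/-! ## The model `⟨lam, R, R_v⟩` for `v ∈ V ∪ W` -/

/-- The unary relation symbols `R` and `R_v`, for `v ∈ F`. -/
inductive BaseRel {Y : Type u} (F : Set (Set Y)) : {n : ℕ} → (Fin n → PUnit.{u + 1}) → Type u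
  | R : BaseRel F (fun _ : Fin 1 => PUnit.unit)
  | Rv (v : F) : BaseRel F (fun _ : Fin 1 => PUnit.unit)

/-- The one-sorted vocabulary with the symbols `R` and `R_v`, for `v ∈ F`. -/
def baseVocab {Y : Type u} (F : Set (Set Y)) : Vocab.{u} where
  Srt := PUnit
  sig :=
    { Rel := fun s => BaseRel F s
      Func := fun _ _ => PEmpty
      Const := fun _ => PEmpty }

/-- The model with universe `Y`, where `R` is interpreted by `X` and each `R_v` by `v`. -/
def baseModel {Y : Type u} (hY : Nonempty Y) (X : Set Y) (F : Set (Set Y)) :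
    Str (baseVocab F) where
  carrier _ := Y
  nonempty _ := hY
  interp :=
    { rel := fun r => match r with
        | BaseRel.R => fun x => x 0 ∈ X
        | BaseRel.Rv v => fun x => x 0 ∈ v.1
      func := fun f => nomatch f
      const := fun c => nomatch c }

/-- Every many-sorted expansion `A` of `⟨lam, R, R_v⟩`, where `R` is the set of all ordinals
`< mu` and `v ∈ V ∪ W`, has an `L`-elementary extension `B` with an element `x`, of the sort
of `lam`, outside all `R_v`, `v ∈ V`. -/
def AbstractLogic.ExpansionsExtend (L : AbstractLogic.{u, v}) (lam mu : Cardinal.{u})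
    (hlam : ℵ₀ ≤ lam) (V W : Set (Set (Base lam))) : Prop :=
  ∀ (τ : Vocab.{u}) (ρ : VocabHom (baseVocab (V ∪ W)) τ), ρ.IsInjective →
    ∀ A : Str τ, Nonempty (Iso (A.reduct ρ) 
        (baseModel (nonempty_base hlam) (below lam mu) (V ∪ W))) →
      ∃ (B : Str τ) (h : ∀ s, A.carrier s → B.carrier s), L.IsElementary A B h ∧
        ∃ x : (B.reduct ρ).carrier PUnit.unit,
          ∀ (v : Set (Base lam)) (hv : v ∈ V),
            ¬ (B.reduct ρ).interp.rel (BaseRel.Rv ⟨v, Or.inl hv⟩) (fun _ => x)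

/-! ## Limit ultrafilters and limit ultrapowers -/

/-- A limit ultrafilter `(D, V)`: an ultrafilter `D` over `I` and a filter `V` over `I × I`. -/
structure LimitUltrafilter : Type (u + 1) where
  I : Type u
  D : Ultrafilter I
  V : Filter (I × I)

namespace LimitUltrafilter

variable (P : LimitUltrafilter.{u})

/-- The set `{(i, j) | f i = f j}`. -/
def eqSet {I M : Type*} (f : I → M) : Set (I × I) := {p | f p.1 = f p.2}

/-- The functions `f : I → M` with `eqSet f ∈ V`. -/
def LimitFun (M : Type u) : Type u := {f : P.I → M // eqSet f ∈ P.V}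

/-- Equality modulo `D`. -/
def limitSetoid (M : Type u) : Setoid (P.LimitFun M) where
  r f g := ∀ᶠ i in (P.D : Filter P.I), f.1 i = g.1 i
  iseqv :=
    { refl := fun _ => Filter.Eventually.of_forall fun _ => rfl
      symm := fun h => h.mono fun _ hi => hi.symm
      trans := fun h₁ h₂ => (h₁.and h₂).mono fun _ hi => hi.1.trans hi.2 }

/-- The limit ultrapower of a set `M`. -/
def Power (M : Type u) : Type u := Quotient (P.limitSetoid M)

/-- A constant function, as an element of the limit ultrapower. -/
def diag {M : Type u} (a : M) : P.Power M :=
  Quotient.mk (P.limitSetoid M) ⟨fun _ => a, by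
    have h : eqSet (fun _ : P.I => a) = Set.univ := by ext; simp [eqSet]
    rw [h]
    exact Filter.univ_mem⟩

/-- A representative of an element of the limit ultrapower. -/
def rep {M : Type u} (x : P.Power M) : P.LimitFun M := Quotient.out x

theorem eqSet_comp_mem {n : ℕ} {M : Fin n → Type u} {N : Type u} (F : (∀ i, M i) → N)
    (g : ∀ i, P.LimitFun (M i)) : eqSet (fun j => F (fun i => (g i).1 j)) ∈ P.V := by
  have h : (⋂ i, eqSet (g i).1) ∈ P.V := Filter.iInter_mem.2 fun i => (g i).2
  refine Filter.mem_of_superset h fun p hp => ?_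
  have hp' : ∀ i, (g i).1 p.1 = (g i).1 p.2 := fun i => Set.mem_iInter.1 hp i
  simp only [eqSet, Set.mem_ofPred_eq, hp']

/-- The limit ultrapower of the structure `A`. Relations and functions are computed on
representatives (the result does not depend on their choice). -/
def power {τ : Vocab.{u}} (A : Str τ) : Str τ where
  carrier s := P.Power (A.carrier s)
  nonempty s := (A.nonempty s).map P.diag
  interp :=
    { rel := fun r x => ∀ᶠ j in (P.D : Filter P.I), A.interp.rel r (fun i => (P.rep (x i)).1 j)
      func := fun f x => Quotient.mk (P.limitSetoid _)
        ⟨fun j => A.interp.func f (fun i => (P.rep (x i)).1 j),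
          P.eqSet_comp_mem (A.interp.func f) (fun i => P.rep (x i))⟩
      const := fun c => P.diag (A.interp.const c) }

/-- `lam`-decomposability of a limit ultrafilter. -/
def IsDecomposable (lam : Cardinal.{u}) : Prop :=
  ∃ f : P.I → Base lam, eqSet f ∈ P.V ∧ ∀ v : Set (Base lam), #v < lam → f ⁻¹' v ∉ P.D

end LimitUltrafilter

/-- The family `F(L)`: all `((D, V), nu)` such that the limit ultrapower by `(D, V)` of every
structure of cardinality at most `nu` is an `L`-elementary extension of it, via the diagonal
embedding. -/
def AbstractLogic.limitFamily (L : AbstractLogic.{u, v}) :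
    Set (LimitUltrafilter.{u} × Cardinal.{u}) :=
  {q | ∀ (τ : Vocab.{u}) (A : Str τ), A.card ≤ q.2 →
    L.IsElementary A (q.1.power A) (fun _ a => q.1.diag a)}

end ManySorted

end

/-! The conditions are proved in a cycle, with one construction for each step.

From compactness to extensions: name all elements of the expansion `A` and all sets `w ∈ V₀`, and
add a constant `c` of the sort of `lam`. Let the theory consist of all sentences true for every
value of `c`, and let `φ_w` say `c ∉ w`. The value `γ` of `c` satisfies every `φ_w` with `γ ∉ w`. So
compactness gives a model of the whole elementary diagram in which `c` avoids every `w`. By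
cofinality it also avoids every `v ∈ V`, because the inclusion `v ⊆ w` is part of the theory.

From extensions to limit ultrafilters: let `M` be a structure with symbols for all its relations,
functions and elements, whose sorts include `lam` and room for every structure of size at most `nu`
(`exists_iso_reduct_full`). Any `B` equivalent to `M` is a limit ultrapower of `M` (`fullIso`). The
indices are the sort-preserving maps `i : B → M`. The ultrafilter contains `{i | R (i b)}` whenever
`R` holds at `b` in `B` (`fullLimit_eventually`). The filter on pairs makes the admissible functions
those depending on finitely many coordinates; such a function is a function symbol of `M` applied to
coordinates, hence equals a single coordinate modulo the ultrafilter (`fullEval_bijective`). The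
coordinate at the new element `x` witnesses decomposability.

From limit ultrafilters to compactness: glue models `A γ` of the partial theories into one structure
fibred over `lam`, and take `nu` above its size. Relativization and substitution make truth in a
fibre expressible (`exists_fibre_sentence`). The limit ultrapower has a fibre over the class of the
decomposing function, and this class lies in no `v ∈ V₀`, so that fibre is the required model. -/

namespace ManySorted

/-! ## Renamings between extensions of vocabularies -/

/-- The inclusion of a vocabulary in an extension of it. -/
def Vocab.incl (τ : Vocab.{u}) (E : Signature.{u} τ.Srt) : VocabHom τ (τ.extend E) where
  srt s := s
  rel r := Sum.inl r
  func f := Sum.inl f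
  const c := Sum.inl c

theorem Vocab.incl_isInjective (τ : Vocab.{u}) (E : Signature.{u} τ.Srt) :
    (τ.incl E).IsInjective where
  srt := fun _ _ h => h
  rel := fun {_ _ _ _} h => Sum.inl_injective h
  func := fun {_ _ _ _ _} h => Sum.inl_injective h
  const := fun {_ _ _} h => Sum.inl_injective h

theorem Str.reduct_incl {τ : Vocab.{u}} {E : Signature.{u} τ.Srt} (A : Str τ)
    (J : Interp E A.carrier) : (A.expand J).reduct (τ.incl E) = A := rfl

def VocabHom.comp {σ τ υ : Vocab.{u}} (ρ : VocabHom τ υ) (π : VocabHom σ τ) : VocabHom σ υ where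
  srt s := ρ.srt (π.srt s)
  rel r := ρ.rel (π.rel r)
  func f := ρ.func (π.func f)
  const c := ρ.const (π.const c)

theorem VocabHom.IsInjective.comp {σ τ υ : Vocab.{u}} {ρ : VocabHom τ υ} {π : VocabHom σ τ}
    (hρ : ρ.IsInjective) (hπ : π.IsInjective) : (ρ.comp π).IsInjective where
  srt := hρ.srt.comp hπ.srt
  rel := fun {_ _ _ _} h => hπ.rel (hρ.rel h)
  func := fun {_ _ _ _ _} h => hπ.func (hρ.func h)
  const := fun {_ _ _} h => hπ.const (hρ.const h)

namespace AbstractLogic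

variable {L : AbstractLogic.{u, v}}

/-! ## Predicates expressible by a sentence with constants for the arguments -/

/-- The predicate `Q` of structures and tuples is expressed by a sentence of `L`. -/
def Expressible (L : AbstractLogic.{u, v}) {τ : Vocab.{u}} {ι : Type} (s : ι → τ.Srt)
    (Q : ∀ A : Str τ, (∀ i, A.carrier (s i)) → Prop) : Prop :=
  ∃ φ : L.Sentence (τ.extend (tupleSig s)), ∀ A x, L.Sat (A.withTuple x) φ ↔ Q A x

/-- The constant symbol for the `i`-th argument. -/
def argTerm {τ : Vocab.{u}} {ι : Type} (s : ι → τ.Srt) (i : ι) :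
    ClosedTerm (τ.extend (tupleSig s)) (s i) :=
  .const (τ := τ.extend (tupleSig s)) (Sum.inr ⟨⟨i, rfl⟩⟩)

variable {τ : Vocab.{u}} {ι : Type} {s : ι → τ.Srt}

theorem IsRegular.expressible_not (hL : L.IsRegular)
    {Q : ∀ A : Str τ, (∀ i, A.carrier (s i)) → Prop} (h : L.Expressible s Q) :
    L.Expressible s (fun A x => ¬ Q A x) := by
  obtain ⟨φ, hφ⟩ := h
  obtain ⟨ψ, hψ⟩ := hL.neg φ
  exact ⟨ψ, fun A x => by rw [hψ, hφ]⟩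

theorem IsRegular.expressible_and (hL : L.IsRegular)
    {Q Q' : ∀ A : Str τ, (∀ i, A.carrier (s i)) → Prop} (h : L.Expressible s Q)
    (h' : L.Expressible s Q') : L.Expressible s (fun A x => Q A x ∧ Q' A x) := by
  obtain ⟨φ, hφ⟩ := h
  obtain ⟨φ', hφ'⟩ := h'
  obtain ⟨ψ, hψ⟩ := hL.conj φ φ'
  exact ⟨ψ, fun A x => by rw [hψ, hφ, hφ']⟩

theorem IsRegular.expressible_imp (hL : L.IsRegular)
    {Q Q' : ∀ A : Str τ, (∀ i, A.carrier (s i)) → Prop} (h : L.Expressible s Q)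
    (h' : L.Expressible s Q') : L.Expressible s (fun A x => Q A x → Q' A x) := by
  obtain ⟨ψ, hψ⟩ := hL.expressible_not (hL.expressible_and h (hL.expressible_not h'))
  exact ⟨ψ, fun A x => by rw [hψ]; tauto⟩

theorem IsRegular.expressible_iff (hL : L.IsRegular)
    {Q Q' : ∀ A : Str τ, (∀ i, A.carrier (s i)) → Prop} (h : L.Expressible s Q)
    (h' : L.Expressible s Q') : L.Expressible s (fun A x => Q A x ↔ Q' A x) := by
  obtain ⟨ψ, hψ⟩ := hL.expressible_and (hL.expressible_imp h h') (hL.expressible_imp h' h)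
  exact ⟨ψ, fun A x => by rw [hψ]; tauto⟩

theorem IsRegular.expressible_rel (hL : L.IsRegular) {n : ℕ} (k : Fin n → ι)
    (r : τ.sig.Rel (fun i => s (k i))) :
    L.Expressible s (fun A x => A.interp.rel r (fun i => x (k i))) := by
  obtain ⟨ψ, hψ⟩ := hL.atom (.rel (τ := τ.extend (tupleSig s)) (Sum.inl r)
    (fun i => argTerm s (k i)))
  exact ⟨ψ, fun A x => hψ _⟩

theorem IsRegular.expressible_func (hL : L.IsRegular) {n : ℕ} (k : Fin n → ι) (j : ι)
    (f : τ.sig.Func (fun i => s (k i)) (s j)) :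
    L.Expressible s (fun A x => A.interp.func f (fun i => x (k i)) = x j) := by
  obtain ⟨ψ, hψ⟩ := hL.atom (.eq (τ := τ.extend (tupleSig s))
    (.app (τ := τ.extend (tupleSig s)) (Sum.inl f) (fun i => argTerm s (k i))) (argTerm s j))
  exact ⟨ψ, fun A x => hψ _⟩

theorem IsRegular.expressible_const (hL : L.IsRegular) (j : ι) (c : τ.sig.Const (s j)) :
    L.Expressible s (fun A x => A.interp.const c = x j) := by
  obtain ⟨ψ, hψ⟩ := hL.atom (.eq (τ := τ.extend (tupleSig s))
    (.const (τ := τ.extend (tupleSig s)) (Sum.inl c)) (argTerm s j))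
  exact ⟨ψ, fun A x => hψ _⟩

/-! ## Quantification over finite tuples -/

/-- The symbols for a tuple of length `n + 1`, seen as symbols for its tail and its head. -/
def splitTuple {n : ℕ} (s : Fin (n + 1) → τ.Srt) :
    VocabHom (τ.extend (tupleSig s))
      ((τ.extend (tupleSig (fun i => s (Fin.succ i)))).extend
        (tupleSig (S := τ.Srt) (fun _ : Unit => s 0))) where
  srt t := t
  rel r := Sum.elim (fun r => Sum.inl (Sum.inl r)) (fun r => nomatch r) r
  func f := Sum.elim (fun f => Sum.inl (Sum.inl f)) (fun f => nomatch f) f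
  const {t} c := Sum.elim (fun c => Sum.inl (Sum.inl c)) (fun c =>
    Fin.cases (motive := fun i => s i = t → _) (fun h => Sum.inr ⟨⟨(), h⟩⟩)
      (fun i h => Sum.inl (Sum.inr ⟨⟨i, h⟩⟩)) c.down.1 c.down.2) c

theorem splitTuple_isInjective {n : ℕ} (s : Fin (n + 1) → τ.Srt) :
    (splitTuple s).IsInjective where
  srt := fun _ _ h => h
  rel := by
    rintro m s' (r | r) (r' | r') h
    · exact congrArg _ (Sum.inl_injective (Sum.inl_injective h))
    all_goals exact nomatch r
  func := by
    rintro m s' t (r | r) (r' | r') h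
    · exact congrArg _ (Sum.inl_injective (Sum.inl_injective h))
    all_goals exact nomatch r
  const := by
    rintro t (c | ⟨⟨i, hi⟩⟩) (c' | ⟨⟨j, hj⟩⟩) h
    · exact congrArg _ (Sum.inl_injective (Sum.inl_injective h))
    · induction j using Fin.cases with
      | zero => exact nomatch h
      | succ j => exact nomatch (Sum.inl_injective h)
    · induction i using Fin.cases with
      | zero => exact nomatch h
      | succ i => exact nomatch (Sum.inl_injective h)
    · induction i using Fin.cases with
      | zero =>
        induction j using Fin.cases with
        | zero => rfl
        | succ j => exact nomatch h
      | succ i =>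
        induction j using Fin.cases with
        | zero => exact nomatch h
        | succ j =>
          have h' := Sum.inr_injective (Sum.inl_injective h)
          have h'' : i = j := congrArg (fun c => c.down.1) h'
          subst h''
          rfl

/-- Symbols for the empty tuple may be left out. -/
def dropTuple (s : Fin 0 → τ.Srt) : VocabHom (τ.extend (tupleSig s)) τ where
  srt t := t
  rel r := Sum.elim (fun r => r) (fun r => nomatch r) r
  func f := Sum.elim (fun f => f) (fun f => nomatch f) f
  const c := Sum.elim (fun c => c) (fun c => c.down.1.elim0) c

theorem dropTuple_isInjective (s : Fin 0 → τ.Srt) : (dropTuple s).IsInjective where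
  srt := fun _ _ h => h
  rel := by
    rintro m s' (r | r) (r' | r') h
    · exact congrArg _ h
    all_goals exact nomatch r
  func := by
    rintro m s' t (r | r) (r' | r') h
    · exact congrArg _ h
    all_goals exact nomatch r
  const := by
    rintro t (c | ⟨⟨i, hi⟩⟩) (c' | ⟨⟨j, hj⟩⟩) h
    · exact congrArg _ h
    all_goals first | exact i.elim0 | exact j.elim0

def isoDropTuple (A : Str τ) {s : Fin 0 → τ.Srt} (x : ∀ i, A.carrier (s i)) :
    Iso (A.reduct (dropTuple s)) (A.withTuple x) where
  equiv _ := Equiv.refl _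
  map_rel := by
    rintro n s' (r | r) y
    · exact Iff.rfl
    · exact nomatch r
  map_func := by
    rintro n s' t (f | f) y
    · rfl
    · exact nomatch f
  map_const := by
    rintro t (c | ⟨⟨i, hi⟩⟩)
    · rfl
    · exact i.elim0

def isoSplitTuple (A : Str τ) {n : ℕ} {s : Fin (n + 1) → τ.Srt} (x : ∀ i, A.carrier (s i)) :
    Iso (((A.withTuple (fun i => x (Fin.succ i))).withTuple
        (s := fun _ : Unit => s 0) (fun _ => x 0)).reduct (splitTuple s)) (A.withTuple x) where
  equiv _ := Equiv.refl _
  map_rel := by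
    rintro n s' (r | r) y
    · exact Iff.rfl
    · exact nomatch r
  map_func := by
    rintro n s' t (f | f) y
    · rfl
    · exact nomatch f
  map_const := by
    rintro t (c | ⟨⟨i, hi⟩⟩)
    · rfl
    · induction i using Fin.cases with
      | zero => rfl
      | succ i => rfl

/-- By induction on the length: `splitTuple` moves the constant for the head into an outer extension
of the vocabulary, where particularization applies. -/
theorem IsRegular.exists_tuple (hL : L.IsRegular) {n : ℕ} {s : Fin n → τ.Srt}
    (φ : L.Sentence (τ.extend (tupleSig s))) :
    ∃ ψ : L.Sentence τ, ∀ A : Str τ, L.Sat A ψ ↔ ∃ x, L.Sat (A.withTuple x) φ := by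
  induction n with
  | zero =>
    obtain ⟨ψ, hψ⟩ := L.exists_rename (dropTuple s) (dropTuple_isInjective s) φ
    refine ⟨ψ, fun A => ?_⟩
    rw [hψ]
    constructor
    · intro h
      exact ⟨fun i => i.elim0, (L.sat_iso _ _ (isoDropTuple A _) φ).1 h⟩
    · rintro ⟨x, h⟩
      exact (L.sat_iso _ _ (isoDropTuple A x) φ).2 h
  | succ n ih =>
    obtain ⟨φ', hφ'⟩ := L.exists_rename (splitTuple s) (splitTuple_isInjective s) φ
    obtain ⟨φ'', hφ''⟩ := hL.particularization
      (τ := τ.extend (tupleSig (fun i => s (Fin.succ i)))) (s 0) φ'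
    obtain ⟨ψ, hψ⟩ := ih φ''
    refine ⟨ψ, fun A => ?_⟩
    rw [hψ]
    constructor
    · rintro ⟨x, h⟩
      obtain ⟨a, h⟩ := (hφ'' _).1 h
      refine ⟨Fin.cons (α := fun i => A.carrier (s i)) a x, ?_⟩
      refine (L.sat_iso _ _ (isoSplitTuple A
        (Fin.cons (α := fun i => A.carrier (s i)) a x)) φ).1 ?_
      exact (hφ' _).1 h
    · rintro ⟨x, h⟩
      refine ⟨fun i => x (Fin.succ i), (hφ'' _).2 ⟨x 0, (hφ' _).2 ?_⟩⟩
      exact (L.sat_iso _ _ (isoSplitTuple A x) φ).2 h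

/-! ### Equivalence of structures and transfer of expressible statements -/

/-- `A` and `B` satisfy the same sentences of `L`. -/
def Equivalent (L : AbstractLogic.{u, v}) (A B : Str τ) : Prop :=
  ∀ φ : L.Sentence τ, L.Sat A φ ↔ L.Sat B φ

/-- Expressible predicates which hold for all tuples are preserved under `L`-equivalence. -/
theorem Equivalent.transfer (hL : L.IsRegular) {A B : Str τ} (hAB : L.Equivalent A B) {n : ℕ}
    {s : Fin n → τ.Srt} {Q : ∀ A : Str τ, (∀ i, A.carrier (s i)) → Prop}
    (hQ : L.Expressible s Q) (h : ∀ x, Q A x) (y : ∀ i, B.carrier (s i)) : Q B y := by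
  obtain ⟨φ, hφ⟩ := hL.expressible_not hQ
  obtain ⟨ψ, hψ⟩ := hL.exists_tuple φ
  -- The existence of a counterexample is a single sentence, so one in `B`, at whatever tuple,
  -- yields one in `A`.
  by_contra hy
  have h1 : L.Sat B ψ := (hψ B).2 ⟨y, (hφ _ _).2 hy⟩
  obtain ⟨x, hx⟩ := (hψ A).1 ((hAB ψ).2 h1)
  exact (hφ _ _).1 hx (h x)

theorem IsElementary.equivalent {A B : Str τ} {h : ∀ s, A.carrier s → B.carrier s}
    (hAB : L.IsElementary A B h) : L.Equivalent A B := by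
  intro φ
  obtain ⟨ψ, hψ⟩ := L.exists_rename (τ.incl (constSig A.carrier)) (τ.incl_isInjective _) φ
  have h1 := hψ (A.expand (constInterp fun _ a => a))
  have h2 := hψ (B.expand (constInterp h))
  rw [Str.reduct_incl] at h1 h2
  rw [← h1, ← h2]
  exact hAB ψ

end AbstractLogic

/-! ## Interpretations -/

/-- The relation symbols of `E`, moved along a map of sorts. -/
inductive Signature.MapRel {S T : Type u} (E : Signature.{u} S) (g : S → T) :
    {n : ℕ} → (Fin n → T) → Type u
  | mk {n : ℕ} {s : Fin n → S} (r : E.Rel s) : MapRel E g (fun i => g (s i))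

/-- The function symbols of `E`, moved along a map of sorts. -/
inductive Signature.MapFunc {S T : Type u} (E : Signature.{u} S) (g : S → T) :
    {n : ℕ} → (Fin n → T) → T → Type u
  | mk {n : ℕ} {s : Fin n → S} {t : S} (f : E.Func s t) : MapFunc E g (fun i => g (s i)) (g t)

/-- The constant symbols of `E`, moved along a map of sorts. -/
inductive Signature.MapConst {S T : Type u} (E : Signature.{u} S) (g : S → T) : T → Type u
  | mk {t : S} (c : E.Const t) : MapConst E g (g t)

/-- A set of symbols, moved along a map of sorts. -/
def Signature.map {S T : Type u} (E : Signature.{u} S) (g : S → T) : Signature.{u} T where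
  Rel s := E.MapRel g s
  Func s t := E.MapFunc g s t
  Const t := E.MapConst g t

def Interp.map {S T : Type u} {E : Signature.{u} S} {g : S → T} {M : T → Type u}
    (J : Interp E (fun s => M (g s))) : Interp (E.map g) M where
  rel r := match r with
    | .mk r => fun x => J.rel r x
  func f := match f with
    | .mk f => fun x => J.func f x
  const c := match c with
    | .mk c => J.const c

/-- The symbols of `σ` as new symbols over the sorts of `τ`. -/
def VocabHom.toMap (σ τ : Vocab.{u}) (g : σ.Srt → τ.Srt) :
    VocabHom σ (τ.extend (σ.sig.map g)) where
  srt := g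
  rel r := Sum.inr (.mk r)
  func f := Sum.inr (.mk f)
  const c := Sum.inr (.mk c)

theorem VocabHom.toMap_isInjective {σ τ : Vocab.{u}} {g : σ.Srt → τ.Srt}
    (hg : Function.Injective g) : (VocabHom.toMap σ τ g).IsInjective where
  srt := hg
  rel := by
    intro n s r r' h
    have hmk := Sum.inr_injective h
    injection hmk
  func := by
    intro n s t r r' h
    have hmk := Sum.inr_injective h
    injection hmk
  const := by
    intro t r r' h
    have hmk := Sum.inr_injective h
    injection hmk

/-- The structure with domains `M ∘ g` and the interpretation `J`. -/
def Str.pull {σ τ : Vocab.{u}} (A : Str τ) (g : σ.Srt → τ.Srt)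
    (J : Interp σ.sig (fun s => A.carrier (g s))) : Str σ where
  carrier s := A.carrier (g s)
  nonempty s := A.nonempty (g s)
  interp := J

namespace AbstractLogic

variable {L : AbstractLogic.{u, v}}

/-- Predicates defining the symbols of `σ` in `τ`-structures. -/
structure Translation (σ τ : Vocab.{u}) (g : σ.Srt → τ.Srt) where
  rel : {n : ℕ} → {s : Fin n → σ.Srt} → σ.sig.Rel s →
    ∀ A : Str τ, (∀ i, A.carrier (g (s i))) → Prop
  func : {n : ℕ} → {s : Fin n → σ.Srt} → {t : σ.Srt} → σ.sig.Func s t →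
    ∀ A : Str τ, (∀ i, A.carrier (g (s i))) → A.carrier (g t)
  const : {t : σ.Srt} → σ.sig.Const t → ∀ A : Str τ, A.carrier (g t)

/-- The interpretation of `σ` given by a translation. -/
def Translation.interp {σ τ : Vocab.{u}} {g : σ.Srt → τ.Srt} (T : Translation σ τ g)
    (A : Str τ) : Interp σ.sig (fun s => A.carrier (g s)) where
  rel r := T.rel r A
  func f := T.func f A
  const c := T.const c A

/-- The definitions used by a translation are sentences of `L`. -/
structure Translation.IsExpressible {σ τ : Vocab.{u}} {g : σ.Srt → τ.Srt} (T : Translation σ τ g)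
    (L : AbstractLogic.{u, v}) : Prop where
  rel : ∀ {n : ℕ} {s : Fin n → σ.Srt} (r : σ.sig.Rel s),
    L.Expressible (fun i => g (s i)) (T.rel r)
  func : ∀ {n : ℕ} {s : Fin n → σ.Srt} {t : σ.Srt} (f : σ.sig.Func s t),
    L.Expressible (fun o : Option (Fin n) => o.elim (g t) (fun i => g (s i)))
      (fun A x => T.func f A (fun i => x (some i)) = x none)
  const : ∀ {t : σ.Srt} (c : σ.sig.Const t),
    L.Expressible (fun _ : Unit => g t) (fun A x => T.const c A = x ())

/-- The sentences of `σ` can be translated. -/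
theorem Translation.IsExpressible.exists_sentence (hL : L.IsRegular) {σ τ : Vocab.{u}}
    {g : σ.Srt → τ.Srt} (hg : Function.Injective g) {T : Translation σ τ g}
    (hT : T.IsExpressible L) (φ : L.Sentence σ) :
    ∃ ψ : L.Sentence τ, ∀ A : Str τ, L.Sat A ψ ↔ L.Sat (A.pull g (T.interp A)) φ := by
  -- The symbols of `σ` are first added to `τ` as new symbols over its sorts; substitution then
  -- eliminates them.
  obtain ⟨φ', hφ'⟩ := L.exists_rename _ (VocabHom.toMap_isInjective (τ := τ) hg) φ
  let δ : L.Definitions τ (σ.sig.map g) :=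
    { rel := fun r => match r with
        | .mk r => (hT.rel r).choose
      func := fun f => match f with
        | .mk f => (hT.func f).choose
      const := fun c => match c with
        | .mk c => (hT.const c).choose }
  obtain ⟨ψ, hψ⟩ := hL.substitution δ φ'
  refine ⟨ψ, fun A => ?_⟩
  rw [hψ A (T.interp A).map ?_, hφ']
  · rfl
  · constructor
    · rintro n _ ⟨r⟩ x
      exact ((hT.rel r).choose_spec A x).symm
    · rintro n _ _ ⟨f⟩ x y
      exact ((hT.func f).choose_spec A (optionTuple x y)).symm
    · rintro _ ⟨c⟩ y
      exact ((hT.const c).choose_spec A (fun _ => y)).symm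

/-- Sentences can be renamed along maps of vocabularies which are injective on sorts. -/
theorem IsRegular.exists_rename_of_srt_injective (hL : L.IsRegular) {σ τ : Vocab.{u}}
    (ρ : VocabHom σ τ) (hρ : Function.Injective ρ.srt) (φ : L.Sentence σ) :
    ∃ ψ : L.Sentence τ, ∀ A : Str τ, L.Sat A ψ ↔ L.Sat (A.reduct ρ) φ := by
  -- Each symbol is defined by an atomic sentence with its image, so distinct symbols may share an
  -- image.
  let T : Translation σ τ ρ.srt :=
    { rel := fun r A x => A.interp.rel (ρ.rel r) x
      func := fun f A x => A.interp.func (ρ.func f) x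
      const := fun c A => A.interp.const (ρ.const c) }
  have hT : T.IsExpressible L :=
    { rel := fun {n s} r => hL.expressible_rel (s := fun i => ρ.srt (s i)) id (ρ.rel r)
      func := fun {n s t} f => hL.expressible_func
        (s := fun o : Option (Fin n) => o.elim (ρ.srt t) (fun i => ρ.srt (s i)))
        some none (ρ.func f)
      const := fun {t} c => hL.expressible_const (s := fun _ : Unit => ρ.srt t) () (ρ.const c) }
  exact hT.exists_sentence hL hρ φ

end AbstractLogic

/-! ## Limit ultrapowers -/

namespace LimitUltrafilter

variable (P : LimitUltrafilter.{u})

theorem rep_mk {M : Type u} (g : P.LimitFun M) :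
    ∀ᶠ j in (P.D : Filter P.I), (P.rep (Quotient.mk (P.limitSetoid M) g)).1 j = g.1 j :=
  Quotient.mk_out (s := P.limitSetoid M) g

theorem mk_eq_mk {M : Type u} {f g : P.LimitFun M} :
    Quotient.mk (P.limitSetoid M) f = Quotient.mk (P.limitSetoid M) g ↔
      ∀ᶠ j in (P.D : Filter P.I), f.1 j = g.1 j :=
  Quotient.eq (r := P.limitSetoid M)

/-- The arguments are finite in number, so any representatives agree with the chosen ones
simultaneously on a set in `D`. -/
theorem power_rel {τ : Vocab.{u}} (A : Str τ) {n : ℕ} {s : Fin n → τ.Srt} (r : τ.sig.Rel s)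
    (g : ∀ i, P.LimitFun (A.carrier (s i))) :
    (P.power A).interp.rel r (fun i => Quotient.mk (P.limitSetoid _) (g i)) ↔
      ∀ᶠ j in (P.D : Filter P.I), A.interp.rel r (fun i => (g i).1 j) := by
  have h := Filter.eventually_all.2 fun i => P.rep_mk (g i)
  refine Filter.eventually_congr (h.mono fun j hj => ?_)
  simp only [hj]

theorem power_func {τ : Vocab.{u}} (A : Str τ) {n : ℕ} {s : Fin n → τ.Srt} {t : τ.Srt}
    (f : τ.sig.Func s t) (g : ∀ i, P.LimitFun (A.carrier (s i))) :
    (P.power A).interp.func f (fun i => Quotient.mk (P.limitSetoid _) (g i)) =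
      Quotient.mk (P.limitSetoid _) ⟨fun j => A.interp.func f (fun i => (g i).1 j),
        P.eqSet_comp_mem (A.interp.func f) g⟩ := by
  have h := Filter.eventually_all.2 fun i => P.rep_mk (g i)
  refine (P.mk_eq_mk).2 (h.mono fun j hj => ?_)
  simp only [hj]

/-- A map of sets induces a map of their limit ultrapowers. -/
def mapFun {M N : Type u} (e : M → N) (f : P.LimitFun M) : P.LimitFun N :=
  ⟨fun j => e (f.1 j), Filter.mem_of_superset f.2 fun _ hp => congrArg e hp⟩

/-- Equivalent sets have equivalent limit ultrapowers. -/
def powerEquiv {M N : Type u} (e : M ≃ N) : P.Power M ≃ P.Power N :=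
  Quotient.congr (ra := P.limitSetoid M) (rb := P.limitSetoid N)
    { toFun := P.mapFun e
      invFun := P.mapFun e.symm
      left_inv := fun _ => Subtype.ext (funext fun _ => e.symm_apply_apply _)
      right_inv := fun _ => Subtype.ext (funext fun _ => e.apply_symm_apply _) }
    fun _ _ => Filter.eventually_congr (Filter.Eventually.of_forall fun _ =>
      (e.apply_eq_iff_eq).symm)

/-- Isomorphic structures have isomorphic limit ultrapowers. -/
def powerIso {τ : Vocab.{u}} {A B : Str τ} (e : Iso A B) : Iso (P.power A) (P.power B) where
  equiv s := P.powerEquiv (e.equiv s)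
  map_rel r x := by
    obtain ⟨g, rfl⟩ : ∃ g : ∀ i, P.LimitFun _, x = fun i => Quotient.mk (P.limitSetoid _) (g i) :=
      ⟨fun i => P.rep (x i), funext fun i => (Quotient.out_eq (s := P.limitSetoid _) (x i)).symm⟩
    exact (P.power_rel A r g).trans ((Filter.eventually_congr (Filter.Eventually.of_forall
      fun j => e.map_rel r _)).trans (P.power_rel B r fun i => P.mapFun (e.equiv _) (g i)).symm)
  map_func f x := by
    obtain ⟨g, rfl⟩ : ∃ g : ∀ i, P.LimitFun _, x = fun i => Quotient.mk (P.limitSetoid _) (g i) :=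
      ⟨fun i => P.rep (x i), funext fun i => (Quotient.out_eq (s := P.limitSetoid _) (x i)).symm⟩
    refine (congrArg (P.powerEquiv (e.equiv _)) (P.power_func A f g)).trans (Eq.trans ?_
      (P.power_func B f fun i => P.mapFun (e.equiv _) (g i)).symm)
    exact congrArg (Quotient.mk (P.limitSetoid _)) (Subtype.ext (funext fun j => e.map_func f _))
  map_const c := by
    refine congrArg (Quotient.mk (P.limitSetoid _)) (Subtype.ext (funext fun j => e.map_const c))

/-- The limit ultrapower of `(A, a)_{a ∈ A}`. -/
def powerExpandIso {τ : Vocab.{u}} (A : Str τ) :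
    Iso (P.power (A.expand (constInterp fun _ a => a)))
      ((P.power A).expand (constInterp fun _ a => P.diag a)) where
  equiv _ := Equiv.refl _
  map_rel := by
    rintro n s (r | r) x
    · exact Iff.rfl
    · exact nomatch r
  map_func := by
    rintro n s t (f | f) x
    · rfl
    · exact nomatch f
  map_const := by
    rintro t (c | c) <;> rfl

end LimitUltrafilter

/-- Naming elements does not enlarge the domains, so the hypothesis covers `(A, a)_{a ∈ A}` too,
whose limit ultrapower names the diagonal elements. -/
theorem AbstractLogic.mem_limitFamily {L : AbstractLogic.{u, v}} {P : LimitUltrafilter.{u}}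
    {nu : Cardinal.{u}}
    (h : ∀ (τ : Vocab.{u}) (A : Str τ), A.card ≤ nu → L.Equivalent A (P.power A)) :
    (P, nu) ∈ L.limitFamily := by
  intro τ A hA φ
  rw [h _ (A.expand (constInterp fun _ a => a)) hA φ]
  exact L.sat_iso _ _ (P.powerExpandIso A) φ

/-! ## Full structures -/

/-- The vocabulary with a relation symbol for each relation on the sets `M s` and each label,
and with a symbol for each function and each element. -/
def fullVocab {S : Type u} (M : S → Type u) (Lab : Type u) : Vocab.{u} where
  Srt := S
  sig :=
    { Rel := fun s => ((∀ i, M (s i)) → Prop) × Lab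
      Func := fun s t => (∀ i, M (s i)) → M t
      Const := fun t => M t }

/-- The structure on the sets `M s` with all relations, functions and constants. -/
def fullStr {S : Type u} (M : S → Type u) (hM : ∀ s, Nonempty (M s)) (Lab : Type u) :
    Str (fullVocab M Lab) where
  carrier := M
  nonempty := hM
  interp :=
    { rel := fun r x => r.1 x
      func := fun f x => f x
      const := fun c => c }

/-! ### Structures equivalent to a full structure -/

section Full

variable {L : AbstractLogic.{u, v}} {S : Type u} {M : S → Type u} {Lab : Type u}

/-- A predicate expressible in `L` agrees in `B` with the symbol for the relation which it
defines on `M`. -/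
theorem full_rel_iff (hL : L.IsRegular) (hM : ∀ s, Nonempty (M s)) (l : Lab)
    {B : Str (fullVocab M Lab)} (hB : L.Equivalent (fullStr M hM Lab) B)
    {n : ℕ} {s : Fin n → S}
    {Q : ∀ A : Str (fullVocab M Lab), (∀ i, A.carrier (s i)) → Prop}
    (hQ : L.Expressible (τ := fullVocab M Lab) s Q) (y : ∀ i, B.carrier (s i)) :
    B.interp.rel (s := s) (fun x => Q (fullStr M hM Lab) x, l) y ↔ Q B y :=
  hB.transfer hL (hL.expressible_iff (hL.expressible_rel (τ := fullVocab M Lab) (s := s) id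
    (fun x => Q (fullStr M hM Lab) x, l)) hQ) (fun _ => Iff.rfl) y

/-- This and the next three lemmas transfer to `B` the facts about relations of `M` that make
`fullFilter` a proper filter. -/
theorem full_rel_univ (hL : L.IsRegular) (hM : ∀ s, Nonempty (M s)) (l : Lab)
    {B : Str (fullVocab M Lab)} (hB : L.Equivalent (fullStr M hM Lab) B)
    {n : ℕ} {s : Fin n → S} (y : ∀ i, B.carrier (s i)) :
    B.interp.rel (s := s) (fun _ => True, l) y :=
  hB.transfer hL (hL.expressible_rel (τ := fullVocab M Lab) (s := s) id (fun _ => True, l))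
    (fun _ => trivial) y

theorem full_rel_and (hL : L.IsRegular) (hM : ∀ s, Nonempty (M s)) (l : Lab)
    {B : Str (fullVocab M Lab)} (hB : L.Equivalent (fullStr M hM Lab) B)
    {n : ℕ} {s : Fin n → S} {R R' : (∀ i, M (s i)) → Prop}
    {y : ∀ i, B.carrier (s i)} (hR : B.interp.rel (s := s) (R, l) y)
    (hR' : B.interp.rel (s := s) (R', l) y) :
    B.interp.rel (s := s) (fun x => R x ∧ R' x, l) y :=
  (full_rel_iff hL hM l hB (hL.expressible_and
    (hL.expressible_rel (τ := fullVocab M Lab) (s := s) id (R, l))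
    (hL.expressible_rel (τ := fullVocab M Lab) (s := s) id (R', l))) y).2 ⟨hR, hR'⟩

theorem full_rel_comp (hL : L.IsRegular) (hM : ∀ s, Nonempty (M s)) (l : Lab)
    {B : Str (fullVocab M Lab)} (hB : L.Equivalent (fullStr M hM Lab) B)
    {n m : ℕ} {s : Fin m → S} (k : Fin n → Fin m)
    {R : (∀ i, M (s (k i))) → Prop} {y : ∀ i, B.carrier (s i)} :
    B.interp.rel (s := s) (fun x => R (fun i => x (k i)), l) y ↔
      B.interp.rel (s := fun i => s (k i)) (R, l) (fun i => y (k i)) :=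
  full_rel_iff hL hM l hB (hL.expressible_rel (τ := fullVocab M Lab) (s := s) k (R, l)) y

theorem full_rel_exists (hL : L.IsRegular) (hM : ∀ s, Nonempty (M s)) (l : Lab)
    {B : Str (fullVocab M Lab)} (hB : L.Equivalent (fullStr M hM Lab) B)
    {n : ℕ} {s : Fin n → S} {R : (∀ i, M (s i)) → Prop}
    {y : ∀ i, B.carrier (s i)} (hR : B.interp.rel (s := s) (R, l) y) : ∃ x, R x := by
  by_contra h
  exact hB.transfer hL (hL.expressible_not
    (hL.expressible_rel (τ := fullVocab M Lab) (s := s) id (R, l))) (fun x hx => h ⟨x, hx⟩) y hR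

/-! ### Representation as a limit ultrapower -/

variable (hL : L.IsRegular) (hM : ∀ s, Nonempty (M s)) (l : Lab) {B : Str (fullVocab M Lab)}
  (hB : L.Equivalent (fullStr M hM Lab) B)

/-- A finite tuple factors through an injective one. -/
theorem exists_injective_factor {X : Type*} {n : ℕ} (b : Fin n → X) :
    ∃ (m : ℕ) (b' : Fin m → X) (k : Fin n → Fin m), Function.Injective b' ∧
      b = fun i => b' (k i) := by
  classical
  let e := (Finset.univ.image b).equivFin
  refine ⟨_, fun j => (e.symm j).1, fun i => e ⟨b i, by simp⟩, ?_, ?_⟩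
  · exact Subtype.val_injective.comp e.symm.injective
  · funext i
    simp

/-- The index set of the limit ultrapower representing `B`: the families assigning to each
element of `B` an element of `M` of the same sort. -/
abbrev FullIndex {S : Type u} {M : S → Type u} {Lab : Type u} (B : Str (fullVocab M Lab)) :
    Type u :=
  ∀ b : (Σ s : S, B.carrier s), M b.1

/-- The sets of index families which contain all the families satisfying some relation of `M` at
a tuple of elements satisfying this relation in `B`. -/
def fullFilter : Filter (FullIndex B) where
  sets := {U | ∃ (n : ℕ) (b : Fin n → Σ s : S, B.carrier s) (R : (∀ k, M (b k).1) → Prop),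
    B.interp.rel (s := fun k => (b k).1) (R, l) (fun k => (b k).2) ∧
      ∀ i : FullIndex B, R (fun k => i (b k)) → i ∈ U}
  univ_sets := by
    refine ⟨0, fun k => k.elim0, fun _ => True, ?_, fun _ _ => trivial⟩
    exact full_rel_univ hL hM l hB _
  sets_of_superset := by
    rintro U U' ⟨n, b, R, h, hU⟩ hUU'
    exact ⟨n, b, R, h, fun i hi => hUU' (hU i hi)⟩
  inter_sets := by
    rintro U U' ⟨n, b, R, h, hU⟩ ⟨n', b', R', h', hU'⟩
    -- Both relations are pulled back to the concatenated tuple, where their conjunction is again a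
    -- relation of `M`.
    obtain ⟨m, c, k, k', rfl, rfl⟩ : ∃ (m : ℕ) (c : Fin m → Σ s : S, B.carrier s)
        (k : Fin n → Fin m) (k' : Fin n' → Fin m),
        b = (fun i => c (k i)) ∧ b' = fun i => c (k' i) :=
      ⟨n + n', Fin.append b b', Fin.castAdd n', Fin.natAdd n, by simp, by simp⟩
    refine ⟨m, c, fun x => R (fun i => x (k i)) ∧ R' (fun i => x (k' i)), ?_,
      fun i hi => ⟨hU i hi.1, hU' i hi.2⟩⟩
    exact full_rel_and hL hM l hB
      ((full_rel_comp hL hM l hB (s := fun i => (c i).1) k).2 h)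
      ((full_rel_comp hL hM l hB (s := fun i => (c i).1) k').2 h')

/-- A relation holding somewhere in `B` is nonempty on `M`, and a tuple satisfying it extends to an
index family. -/
theorem fullFilter_neBot : (fullFilter hL hM l hB).NeBot := by
  classical
  refine Filter.neBot_iff.2 fun h0 => ?_
  have h : (∅ : Set (FullIndex B)) ∈ fullFilter hL hM l hB := by rw [h0]; trivial
  obtain ⟨n, b, R, h, hU⟩ := h
  -- If `b` has repeated entries, a tuple satisfying `R` need not have the form `i ∘ b`. Over the
  -- injective tuple `b'` every tuple arises from some `i`.
  obtain ⟨m, b', k, hb', rfl⟩ := exists_injective_factor b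
  obtain ⟨x, hx⟩ := full_rel_exists hL hM l hB
    ((full_rel_comp hL hM l hB (s := fun i => (b' i).1) (y := fun i => (b' i).2) k).2 h)
  let i : FullIndex B := fun c =>
    if hc : ∃ j, b' j = c then hc.choose_spec ▸ x hc.choose else (hM c.1).some
  have hi : ∀ j, i (b' j) = x j := by
    intro j
    have hc : ∃ j', b' j' = b' j := ⟨j, rfl⟩
    have key : ∀ j' (e : b' j' = b' j), (e ▸ x j' : M (b' j).1) = x j := by
      intro j' e
      obtain rfl := hb' e
      rfl
    simp only [i, dif_pos hc]
    exact key _ _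
  refine hU i ?_
  simp only [hi]
  exact hx

/-- An ultrafilter extending `fullFilter`. -/
noncomputable def fullUltrafilter : Ultrafilter (FullIndex B) :=
  @Ultrafilter.of _ (fullFilter hL hM l hB) (fullFilter_neBot hL hM l hB)

/-- The limit ultrafilter whose limit ultrapower of the full structure is `B`. -/
noncomputable def fullLimit : LimitUltrafilter.{u} where
  I := FullIndex B
  D := fullUltrafilter hL hM l hB
  V := ⨅ b : Σ s : S, B.carrier s, Filter.principal (LimitUltrafilter.eqSet fun i => i b)

/-- A Łoś theorem with `B` in place of the ultrapower. The relation which `Q` defines on `M` has a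
symbol, true at `y` in `B`, and this puts the set of indices in the filter. The converse is the same
argument for `¬ Q`, by maximality of the ultrafilter. -/
theorem fullLimit_eventually {n : ℕ} {s : Fin n → S}
    {Q : ∀ A : Str (fullVocab M Lab), (∀ i, A.carrier (s i)) → Prop}
    (hQ : L.Expressible (τ := fullVocab M Lab) s Q) (y : ∀ i, B.carrier (s i)) :
    Q B y ↔ ∀ᶠ i : FullIndex B in (fullUltrafilter hL hM l hB : Filter (FullIndex B)),
      Q (fullStr M hM Lab) (fun k => i ⟨s k, y k⟩) := by
  have hle : (fullUltrafilter hL hM l hB : Filter (FullIndex B)) ≤ fullFilter hL hM l hB :=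
    @Ultrafilter.of_le _ (fullFilter hL hM l hB) (fullFilter_neBot hL hM l hB)
  have key : ∀ {Q : ∀ A : Str (fullVocab M Lab), (∀ i, A.carrier (s i)) → Prop},
      L.Expressible (τ := fullVocab M Lab) s Q → Q B y →
      ∀ᶠ i : FullIndex B in (fullUltrafilter hL hM l hB : Filter (FullIndex B)),
        Q (fullStr M hM Lab) (fun k => i ⟨s k, y k⟩) := fun {Q} hQ h =>
    hle ⟨n, fun k => ⟨s k, y k⟩, fun x => Q (fullStr M hM Lab) x,
      (full_rel_iff hL hM l hB hQ y).2 h, fun _ hi => hi⟩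
  refine ⟨key hQ, fun h => ?_⟩
  by_contra hn
  exact (Ultrafilter.eventually_not.1 (key (hL.expressible_not hQ) hn)) h

/-- The element of the limit ultrapower given by an element of `B`. -/
def fullEval {s : S} (y : B.carrier s) : (fullLimit hL hM l hB).LimitFun (M s) :=
  ⟨fun i : FullIndex B => i ⟨s, y⟩, Filter.mem_iInf_of_mem (⟨s, y⟩ : Σ s : S, B.carrier s)
    (Filter.mem_principal_self _)⟩

/-- The graph of `G` is expressible, with the value in position `0`, and `B` satisfies it at its own
value of `G`. -/
theorem fullEval_func {n : ℕ} {s : Fin n → S} {t : S} (G : (∀ i, M (s i)) → M t)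
    (y : ∀ i, B.carrier (s i)) :
    ∀ᶠ i : FullIndex B in (fullUltrafilter hL hM l hB : Filter (FullIndex B)),
      G (fun k => i ⟨s k, y k⟩) = i ⟨t, B.interp.func (s := s) (t := t) G y⟩ := by
  have hQ := hL.expressible_func (τ := fullVocab M Lab) (s := (Fin.cons t s : Fin (n + 1) → S))
    Fin.succ 0 G
  exact (fullLimit_eventually hL hM l hB hQ
    (Fin.cons (α := fun k => B.carrier ((Fin.cons t s : Fin (n + 1) → S) k))
      (B.interp.func (s := s) (t := t) G y) y)).1 rfl

/-- Injectivity holds because equality is expressible. For surjectivity, an admissible function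
depends on finitely many coordinates `b`, so it is `G (i b)` for a function `G` of `M`; its preimage
is the value in `B` of the symbol `G` at `b`. -/
theorem fullEval_bijective (s : S) : Function.Bijective fun y : B.carrier s =>
    Quotient.mk ((fullLimit hL hM l hB).limitSetoid (M s)) (fullEval hL hM l hB y) := by
  constructor
  · intro y z h
    have h' := (LimitUltrafilter.mk_eq_mk _).1 h
    obtain ⟨φ, hφ⟩ := hL.atom (.eq (τ := (fullVocab M Lab).extend (tupleSig fun _ : Fin 2 => s))
      (AbstractLogic.argTerm (τ := fullVocab M Lab) (fun _ : Fin 2 => s) 0)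
      (AbstractLogic.argTerm (τ := fullVocab M Lab) (fun _ : Fin 2 => s) 1))
    have hQ : L.Expressible (τ := fullVocab M Lab) (fun _ : Fin 2 => s)
      (fun A x => x 0 = x 1) := ⟨φ, fun A x => hφ _⟩
    exact (fullLimit_eventually hL hM l hB hQ ![y, z]).2 h'
  · intro q
    induction q using Quotient.inductionOn with
    | h g =>
      obtain ⟨g, hg⟩ := g
      -- A set in the generated filter is controlled by a finite set `t` of coordinates.
      obtain ⟨t, ht⟩ := (Filter.mem_iInf_finite _).1 hg
      have hiff : (⨅ b ∈ t, Filter.principal (LimitUltrafilter.eqSet fun i : FullIndex B => i b)) =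
          Filter.principal (⋂ b ∈ t, LimitUltrafilter.eqSet fun i : FullIndex B => i b) :=
        Filter.iInf_principal_finset t _
      have hsub : ∀ i j : FullIndex B, (∀ b ∈ t, i b = j b) → g i = g j := by
        intro i j hij
        have ht' := Filter.mem_principal.1 (hiff ▸ ht)
        exact ht' (show (i, j) ∈ _ by simpa [LimitUltrafilter.eqSet] using hij)
      let e := t.equivFin
      let b : Fin t.card → Σ s : S, B.carrier s := fun k => (e.symm k).1
      have hb : ∀ c ∈ t, ∃ k, b k = c := fun c hc => ⟨e ⟨c, hc⟩, by simp [b]⟩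
      classical
      -- The chosen family does not matter, by `hsub`; the default is never met at a tuple coming
      -- from a family.
      let G : (∀ k, M (b k).1) → M s := fun x =>
        if h : ∃ i : FullIndex B, (fun k => i (b k)) = x then g h.choose else (hM s).some
      have hG : ∀ i : FullIndex B, G (fun k => i (b k)) = g i := by
        intro i
        have h : ∃ j : FullIndex B, (fun k => j (b k)) = fun k => i (b k) := ⟨i, rfl⟩
        simp only [G, dif_pos h]
        refine hsub _ _ fun c hc => ?_
        obtain ⟨k, rfl⟩ := hb c hc
        exact congrFun h.choose_spec k
      refine ⟨B.interp.func (s := fun k => (b k).1) (t := s) G (fun k => (b k).2), ?_⟩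
      refine (LimitUltrafilter.mk_eq_mk _).2 ?_
      refine (fullEval_func hL hM l hB G fun k => (b k).2).mono fun i hi => ?_
      exact hi.symm.trans (hG i)

/-- Each structure equivalent to a full structure is one of its limit ultrapowers. -/
noncomputable def fullIso : Iso B ((fullLimit hL hM l hB).power (fullStr M hM Lab)) where
  equiv s := Equiv.ofBijective _ (fullEval_bijective hL hM l hB s)
  map_rel r x := by
    refine (fullLimit_eventually hL hM l hB
      (hL.expressible_rel (τ := fullVocab M Lab) id r) x).trans ?_
    exact (LimitUltrafilter.power_rel _ (fullStr M hM Lab) r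
      fun i => fullEval hL hM l hB (x i)).symm
  map_func f x := by
    refine Eq.trans ?_ (LimitUltrafilter.power_func _ (fullStr M hM Lab) f
      fun i => fullEval hL hM l hB (x i)).symm
    refine (LimitUltrafilter.mk_eq_mk _).2 ?_
    exact (fullEval_func hL hM l hB f x).mono fun i hi => hi.symm
  map_const {t} c := by
    refine (LimitUltrafilter.mk_eq_mk _).2 ?_
    refine ((fullLimit_eventually hL hM l hB (hL.expressible_const (τ := fullVocab M Lab)
      (s := fun _ : Fin 1 => t) 0 c) fun _ => B.interp.const c).1 rfl).mono fun i hi => hi.symm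

end Full

/-! ## From compactness to extensions -/

/-- Unary relation symbols on the sort `t`, indexed by `F`. -/
inductive FamilyRel {S : Type u} (t : S) (F : Type u) : {n : ℕ} → (Fin n → S) → Type u
  | on (v : F) : FamilyRel t F (fun _ : Fin 1 => t)

/-- A family of new unary relation symbols on the sort `t`. -/
def familySig {S : Type u} (t : S) (F : Type u) : Signature.{u} S where
  Rel s := FamilyRel t F s
  Func _ _ := PEmpty
  Const _ := PEmpty

def familyInterp {S : Type u} {M : S → Type u} {t : S} {F : Type u} (X : F → Set (M t)) :
    Interp (familySig t F) M where
  rel r := match r with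
    | FamilyRel.on v => fun x => x 0 ∈ X v
  func f := nomatch f
  const c := nomatch c

/-- Compactness is applied to sentences about a generic point of `lam`; the elementary diagram of
`A` does not mention this point. -/
theorem AbstractLogic.IsCompactRelTo.expansionsExtend {L : AbstractLogic.{u, v}}
    (hL : L.IsRegular) {lam mu : Cardinal.{u}} (hlam : ℵ₀ ≤ lam) {V₀ V W : Set (Set (Base lam))}
    (hV₀ : IsCofinalFamily Set.univ lam V₀) (hV : IsCofinalFamily Set.univ lam V)
    (h : L.IsCompactRelTo lam V₀) : L.ExpansionsExtend lam mu hlam V W := by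
  rintro τ ρ hρ A ⟨e⟩
  let t : τ.Srt := ρ.srt PUnit.unit
  let e₀ : A.carrier t ≃ Base lam := e.equiv PUnit.unit
  let τ₁ := τ.extend (constSig A.carrier)
  let A₁ : Str τ₁ := A.expand (constInterp fun _ a => a)
  -- The members of `V₀` need not be named in `A`, so they get symbols of their own.
  let τ₂ := τ₁.extend (familySig (S := τ.Srt) t V₀)
  let A₂ : Str τ₂ := A₁.expand (familyInterp (M := A.carrier) (t := t)
    fun w : V₀ => {a | e₀ a ∈ w.1})
  let s : Fin 1 → τ₂.Srt := fun _ => t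
  have hR : ∀ w : V₀, L.Expressible (τ := τ₂) s (fun C x =>
      ¬ C.interp.rel (s := s) (Sum.inr (FamilyRel.on w)) x) := fun w =>
    hL.expressible_not (hL.expressible_rel (τ := τ₂) (s := s) id (Sum.inr (FamilyRel.on w)))
  choose φ hφ using hR
  let T : Set (L.Sentence (τ₂.extend (tupleSig s))) :=
    {ψ | ∀ x, L.Sat (A₂.withTuple (s := s) x) ψ}
  obtain ⟨C, hC⟩ := h _ T φ (by
    intro γ
    refine ⟨A₂.withTuple (s := s) fun _ => e₀.symm γ, ?_⟩
    rintro ψ (hψ | ⟨w, hw, rfl⟩)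
    · exact hψ _
    · refine (hφ w _ _).2 fun hx => hw ?_
      have : e₀ (e₀.symm γ) ∈ w.1 := hx
      rwa [Equiv.apply_symm_apply] at this)
  let ρ₁ : VocabHom τ₁ (τ₂.extend (tupleSig s)) := (τ₂.incl _).comp (τ₁.incl _)
  have hρ₁ : ρ₁.IsInjective := (τ₂.incl_isInjective _).comp (τ₁.incl_isInjective _)
  let C₁ : Str τ₁ := C.reduct ρ₁
  let B : Str τ := C₁.reduct (τ.incl _)
  let g : ∀ s, A.carrier s → B.carrier s := fun s a => C₁.interp.const (Sum.inr a)
  have hiso : Iso C₁ (B.expand (constInterp g)) :=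
    { equiv := fun _ => Equiv.refl _
      map_rel := by
        rintro n s (r | r) x
        · exact Iff.rfl
        · exact nomatch r
      map_func := by
        rintro n s t (f | f) x
        · rfl
        · exact nomatch f
      map_const := by
        rintro t (c | c) <;> rfl }
  have hmp : ∀ χ : L.Sentence τ₁, L.Sat A₁ χ → L.Sat C₁ χ := by
    intro χ hχ
    obtain ⟨ψ, hψ⟩ := L.exists_rename ρ₁ hρ₁ χ
    exact (hψ C).1 (hC ψ (Or.inl fun x => (hψ _).2 hχ))
  refine ⟨B, g, fun χ => ?_, C.interp.const (Sum.inr ⟨⟨0, rfl⟩⟩), ?_⟩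
  · rw [← L.sat_iso _ _ hiso χ]
    refine ⟨hmp χ, fun hχ => ?_⟩
    -- Preservation in one direction suffices, by passing to the negation.
    by_contra hn
    obtain ⟨χ', hχ'⟩ := hL.neg χ
    exact (hχ' _).1 (hmp χ' ((hχ' _).2 hn)) hχ
  · intro v hv hx
    obtain ⟨w, hw, hvw⟩ := hV₀.2 v (Set.subset_univ _) (hV.1 v hv).2
    -- Here `θ'` excludes that the new constant is in `v` and outside `w`. It holds for every value
    -- of the constant since `v ⊆ w`, but fails in `C` under the assumption `hx`.
    obtain ⟨ψ, hψ⟩ := hL.atom (τ := τ₂.extend (tupleSig s))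
      (.rel (s := s) (Sum.inl (Sum.inl (Sum.inl (ρ.rel (BaseRel.Rv ⟨v, Or.inl hv⟩)))))
        fun _ => AbstractLogic.argTerm s 0)
    obtain ⟨χ, hχ⟩ := hL.neg (φ ⟨w, hw⟩)
    obtain ⟨χ', hχ'⟩ := hL.neg χ
    obtain ⟨θ, hθ⟩ := hL.conj ψ χ'
    obtain ⟨θ', hθ'⟩ := hL.neg θ
    have hmem : θ' ∈ T := by
      intro x
      rw [hθ', hθ, hχ', hχ, hφ, hψ]
      rintro ⟨h1, h2⟩
      refine h2 fun h3 => h3 ?_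
      have h4 := (e.map_rel (BaseRel.Rv ⟨v, Or.inl hv⟩) (fun _ => x 0)).1 h1
      exact hvw h4
    have h1 := hC θ' (Or.inl hmem)
    rw [hθ', hθ, hχ', hχ] at h1
    exact h1 ⟨(hψ _).2 hx, fun h2 => h2 (hC _ (Or.inr ⟨⟨w, hw⟩, rfl⟩))⟩

/-! ## From extensions to limit ultrapowers -/

/-- The domains of a full structure in which `lam` and all structures of cardinality at most
`nu` are embedded. -/
def universalDomain (lam nu : Cardinal.{u}) :
    Option (Base nu × {X : Set (Base nu) // X.Nonempty}) → Type u
  | none => Base lam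
  | some p => ↥p.2.1

theorem universalDomain_nonempty {lam : Cardinal.{u}} (hlam : ℵ₀ ≤ lam) (nu : Cardinal.{u}) :
    ∀ s, Nonempty (universalDomain lam nu s)
  | none => nonempty_base hlam
  | some p => p.2.2.to_subtype

/-- Each structure of cardinality at most `nu` is a reduct of the full structure, along a map of
vocabularies which is injective on sorts. -/
theorem exists_iso_reduct_full {lam nu : Cardinal.{u}} (hlam : ℵ₀ ≤ lam) {Lab : Type u} (l : Lab)
    {τ : Vocab.{u}} (A : Str τ) (hA : A.card ≤ nu) :
    ∃ ρ : VocabHom τ (fullVocab (universalDomain lam nu) Lab), Function.Injective ρ.srt ∧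
      Nonempty (Iso A ((fullStr _ (universalDomain_nonempty hlam nu) Lab).reduct ρ)) := by
  have hA' : #(Σ s, A.carrier s) ≤ #(Base nu) := by rwa [Cardinal.mk_ord_toType]
  obtain ⟨j⟩ := hA'
  have hj : ∀ s, Function.Injective fun a : A.carrier s => j ⟨s, a⟩ := fun s a b h => by
    have := j.injective h
    simpa using this
  -- The image under `j` of an element of the sort serves as a tag from which the sort can be
  -- recovered.
  let g : τ.Srt → Option (Base nu × {X : Set (Base nu) // X.Nonempty}) := fun s =>
    some (j ⟨s, (A.nonempty s).some⟩,
      ⟨Set.range fun a : A.carrier s => j ⟨s, a⟩, ⟨_, ⟨(A.nonempty s).some, rfl⟩⟩⟩)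
  have hg : Function.Injective g := by
    intro s s' h
    have h' := congrArg Prod.fst (Option.some.inj h)
    exact congrArg Sigma.fst (j.injective h')
  let e : ∀ s, A.carrier s ≃ universalDomain lam nu (g s) := fun s => Equiv.ofInjective _ (hj s)
  -- Symbols go to their own interpretations. Symbols interpreted alike are identified, so only
  -- injectivity on sorts is available.
  let ρ : VocabHom τ (fullVocab (universalDomain lam nu) Lab) :=
    { srt := g
      rel := fun {n s} r => (fun x => A.interp.rel r (fun i => (e (s i)).symm (x i)), l)
      func := fun {n s t} f x => e t (A.interp.func f (fun i => (e (s i)).symm (x i)))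
      const := fun {t} c => e t (A.interp.const c) }
  refine ⟨ρ, hg, ⟨?_⟩⟩
  exact
    { equiv := e
      map_rel := fun {n s} r x => by
        show _ ↔ A.interp.rel r (fun i => (e (s i)).symm (e (s i) (x i)))
        simp only [Equiv.symm_apply_apply]
      map_func := fun {n s t} f x => by
        show _ = e t (A.interp.func f (fun i => (e (s i)).symm (e (s i) (x i))))
        simp only [Equiv.symm_apply_apply]
        rfl
      map_const := fun c => rfl }

/-- One extension of one full structure handles all structures of size at most `nu`, as these are
its reducts up to isomorphism. -/
theorem AbstractLogic.ExpansionsExtend.exists_limitUltrafilter {L : AbstractLogic.{u, v}}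
    (hL : L.IsRegular) {lam mu : Cardinal.{u}} (hlam : ℵ₀ ≤ lam) {V W : Set (Set (Base lam))}
    (hV : IsCofinalFamily Set.univ lam V) (h : L.ExpansionsExtend lam mu hlam V W)
    (nu : Cardinal.{u}) :
    ∃ P : LimitUltrafilter.{u}, P.IsDecomposable lam ∧ (P, nu) ∈ L.limitFamily := by
  let M := universalDomain lam nu
  let hM := universalDomain_nonempty hlam nu
  -- Labels separate `R` from `R_v` in case `below lam mu` itself belongs to `V ∪ W`.
  let Lab : Type u := Option (Set (Base lam))
  let ρ : VocabHom (baseVocab (V ∪ W)) (fullVocab M Lab) :=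
    { srt := fun _ => none
      rel := fun r => match r with
        | BaseRel.R => ((fun x => x 0 ∈ below lam mu), none)
        | BaseRel.Rv v => ((fun x => x 0 ∈ v.1), some v.1)
      func := fun f => nomatch f
      const := fun c => nomatch c }
  have hρ : ρ.IsInjective :=
    { srt := fun _ _ _ => rfl
      rel := by
        rintro n s r r' hr
        have hr' := congrArg Prod.snd hr
        cases r with
        | R =>
          cases r' with
          | R => rfl
          | Rv v' => exact nomatch hr'
        | Rv v =>
          cases r' with
          | R => exact nomatch hr'
          | Rv v' => exact congrArg _ (Subtype.ext (Option.some.inj hr'))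
      func := fun {_ _ _} f => nomatch f
      const := fun {_} c => nomatch c }
  obtain ⟨B, g, hB, x, hx⟩ := h _ ρ hρ (fullStr M hM Lab) ⟨
    { equiv := fun _ => Equiv.refl _
      map_rel := by
        rintro n s r x
        cases r <;> exact Iff.rfl
      map_func := fun f => nomatch f
      map_const := fun c => nomatch c }⟩
  have hB' := hB.equivalent
  let P := fullLimit hL hM none hB'
  refine ⟨P, ⟨(fullEval hL hM none hB' (s := none) x).1, (fullEval hL hM none hB' (s := none) x).2,
    fun v hv hmem => ?_⟩, AbstractLogic.mem_limitFamily fun τ A hA φ => ?_⟩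
  -- If `i x ∈ v` for almost all `i`, then also `i x ∈ w`, so `x` would satisfy `R_w` in `B`.
  · obtain ⟨w, hw, hvw⟩ := hV.2 v (Set.subset_univ _) hv
    refine hx w hw ((fullLimit_eventually hL hM none hB' (hL.expressible_rel
      (τ := fullVocab M Lab) (s := fun _ : Fin 1 => none) id
      (ρ.rel (BaseRel.Rv ⟨w, Or.inl hw⟩))) fun _ => x).2 ?_)
    exact Filter.mem_of_superset hmem fun i hi => hvw hi
  · obtain ⟨π, hπ, ⟨e⟩⟩ := exists_iso_reduct_full hlam (none : Lab) A hA
    obtain ⟨ψ, hψ⟩ := hL.exists_rename_of_srt_injective π hπ φ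
    -- Everything is moved to the full structure and its limit ultrapower `B`; limit ultrapowers
    -- commute definitionally with reducts.
    rw [L.sat_iso _ _ e φ, L.sat_iso _ _ (P.powerIso e) φ, ← hψ, hB' ψ,
      L.sat_iso _ _ (fullIso hL hM none hB') ψ, hψ]
    rfl

/-! ## From limit ultrapowers to compactness -/

/-- Relation symbols for families of `τ`-structures: each symbol of `τ` gets an additional
argument of the new sort `none`, on which there are also unary relations indexed by `F`. -/
inductive FibreRel (τ : Vocab.{u}) (F : Type u) : {n : ℕ} → (Fin n → Option τ.Srt) → Type u
  | rel {n : ℕ} {s : Fin n → τ.Srt} (r : τ.sig.Rel s) :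
      FibreRel τ F (Fin.cons none (fun i => some (s i)) : Fin (n + 1) → Option τ.Srt)
  | family (v : F) : FibreRel τ F (fun _ : Fin 1 => none)

/-- Function symbols for families of `τ`-structures: the symbols of `τ`, with an additional
argument, and a projection from each sort to the sort `none`. -/
inductive FibreFunc (τ : Vocab.{u}) :
    {n : ℕ} → (Fin n → Option τ.Srt) → Option τ.Srt → Type u
  | func {n : ℕ} {s : Fin n → τ.Srt} {t : τ.Srt} (f : τ.sig.Func s t) :
      FibreFunc τ (Fin.cons none (fun i => some (s i)) : Fin (n + 1) → Option τ.Srt) (some t)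
  | const {t : τ.Srt} (c : τ.sig.Const t) : FibreFunc τ (fun _ : Fin 1 => none) (some t)
  | proj (t : τ.Srt) : FibreFunc τ (fun _ : Fin 1 => some t) none

/-- The vocabulary of families of `τ`-structures. -/
def fibreVocab (τ : Vocab.{u}) (F : Type u) : Vocab.{u} where
  Srt := Option τ.Srt
  sig :=
    { Rel := fun s => FibreRel τ F s
      Func := fun s t => FibreFunc τ s t
      Const := fun _ => PEmpty }

/-! ### Fibred families and truth in a fibre -/

section Fibre

variable {τ : Vocab.{u}} {F : Type u}

/-- The projection to the sort `none`. -/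
def Str.proj (N : Str (fibreVocab τ F)) {t : τ.Srt} (y : N.carrier (some t)) : N.carrier none :=
  N.interp.func (FibreFunc.proj t) (fun _ => y)

/-- The tuple of an element of the sort `none` and elements of other sorts. -/
def Str.consTuple (N : Str (fibreVocab τ F)) {n : ℕ} {s : Fin n → τ.Srt} (x : N.carrier none)
    (y : ∀ i, N.carrier (some (s i))) :
    ∀ i, N.carrier ((Fin.cons none (fun i => some (s i)) : Fin (n + 1) → Option τ.Srt) i) :=
  Fin.cons (α := fun i =>
    N.carrier ((Fin.cons none (fun i => some (s i)) : Fin (n + 1) → Option τ.Srt) i)) x y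

/-- The values of the symbols of `τ` lie in the fibre given by the additional argument, and the
projections are surjective. -/
structure Str.IsFibred (N : Str (fibreVocab τ F)) : Prop where
  func : ∀ {n : ℕ} {s : Fin n → τ.Srt} {t : τ.Srt} (f : τ.sig.Func s t)
    (z : ∀ i, N.carrier ((Fin.cons none (fun i => some (s i)) : Fin (n + 1) → Option τ.Srt) i)),
    N.proj (N.interp.func (FibreFunc.func f) z) = z 0
  const : ∀ {t : τ.Srt} (c : τ.sig.Const t) (x : Fin 1 → N.carrier none),
    N.proj (N.interp.func (FibreFunc.const c) x) = x 0
  surj : ∀ (t : τ.Srt) (x : N.carrier none), ∃ y : N.carrier (some t), N.proj y = x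

/-- The `τ`-structure on the domains of `N` given by the value `x` of the additional argument. -/
def Str.at (N : Str (fibreVocab τ F)) (x : N.carrier none) : Str τ where
  carrier s := N.carrier (some s)
  nonempty s := N.nonempty (some s)
  interp :=
    { rel := fun r y => N.interp.rel (FibreRel.rel r) (N.consTuple x y)
      func := fun f y => N.interp.func (FibreFunc.func f) (N.consTuple x y)
      const := fun c => N.interp.func (FibreFunc.const c) (fun _ => x) }

/-- The domains of the fibre over `x`. -/
def Str.fibreSet (N : Str (fibreVocab τ F)) (x : N.carrier none) (t : τ.Srt) :
    Set ((N.at x).carrier t) :=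
  {y | N.proj y = x}

theorem Str.IsFibred.isClosed {N : Str (fibreVocab τ F)} (hN : N.IsFibred)
    (x : N.carrier none) : (N.at x).IsClosed (N.fibreSet x) where
  nonempty t := hN.surj t x
  func f y _ := hN.func f (N.consTuple x y)
  const c := hN.const c (fun _ => x)

/-- The fibre over `x`. -/
def Str.fibre (N : Str (fibreVocab τ F)) (hN : N.IsFibred) (x : N.carrier none) : Str τ :=
  (N.at x).restrict (N.fibreSet x) (hN.isClosed x)

/-- A tuple consisting of a single element of the sort `none`. -/
abbrev noneTuple (τ : Vocab.{u}) (F : Type u) : Fin 1 → (fibreVocab τ F).Srt := fun _ => none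

/-- Structures for the vocabulary of families with a distinguished element of the sort `none`. -/
abbrev pointedVocab (τ : Vocab.{u}) (F : Type u) : Vocab.{u} :=
  (fibreVocab τ F).extend (tupleSig (noneTuple τ F))

/-- The family underlying a structure with a distinguished element. -/
abbrev Str.unpoint (N : Str (pointedVocab τ F)) : Str (fibreVocab τ F) :=
  N.reduct ((fibreVocab τ F).incl _)

/-- The symbol for the distinguished element. -/
def pointConst (τ : Vocab.{u}) (F : Type u) : (pointedVocab τ F).sig.Const none :=
  Sum.inr ⟨⟨0, rfl⟩⟩

def Str.point (N : Str (pointedVocab τ F)) : N.unpoint.carrier none :=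
  N.interp.const (pointConst τ F)

/-- The translation defining the symbols of `τ` and the domains of the fibre over the
distinguished element. -/
def fibreTranslation (τ : Vocab.{u}) (F : Type u) :
    AbstractLogic.Translation (τ.extend (unarySig τ.Srt)) (pointedVocab τ F) some where
  rel r N := ((N.unpoint.at N.point).expand (unaryInterp (N.unpoint.fibreSet N.point))).interp.rel r
  func f N := ((N.unpoint.at N.point).expand
    (unaryInterp (N.unpoint.fibreSet N.point))).interp.func f
  const c N := ((N.unpoint.at N.point).expand
    (unaryInterp (N.unpoint.fibreSet N.point))).interp.const c

section

variable {ι : Type} (s : ι → (pointedVocab τ F).Srt)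

/-- The distinguished element as a term. -/
def pointTerm : ClosedTerm ((pointedVocab τ F).extend (tupleSig s)) none :=
  .const (τ := (pointedVocab τ F).extend (tupleSig s)) (Sum.inl (pointConst τ F))

/-- The tuple of terms for the distinguished element and given terms. -/
def consTerm {n : ℕ} {s' : Fin n → τ.Srt}
    (a : ∀ i, ClosedTerm ((pointedVocab τ F).extend (tupleSig s)) (some (s' i))) :
    ∀ i, ClosedTerm ((pointedVocab τ F).extend (tupleSig s))
      ((Fin.cons none (fun i => some (s' i)) : Fin (n + 1) → Option τ.Srt) i) :=
  Fin.cons (α := fun i => ClosedTerm ((pointedVocab τ F).extend (tupleSig s))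
      ((Fin.cons none (fun i => some (s' i)) : Fin (n + 1) → Option τ.Srt) i)) (pointTerm s) a

theorem eval_consTerm (N : Str (pointedVocab τ F)) (x : ∀ i, N.carrier (s i)) {n : ℕ}
    {s' : Fin n → τ.Srt}
    (a : ∀ i, ClosedTerm ((pointedVocab τ F).extend (tupleSig s)) (some (s' i))) :
    (fun i => (consTerm s a i).eval (N.withTuple x)) =
      N.unpoint.consTuple N.point fun i => (a i).eval (N.withTuple x) := by
  funext i
  induction i using Fin.cases with
  | zero => rfl
  | succ i => rfl

end

/-- Atomic sentences suffice: the distinguished point fills the additional argument, and the domain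
of the fibre is given by an equation for the projection. -/
theorem fibreTranslation_isExpressible {L : AbstractLogic.{u, v}} (hL : L.IsRegular) :
    (fibreTranslation τ F).IsExpressible L where
  rel := by
    rintro n s (r | r)
    · let s' : Fin n → (pointedVocab τ F).Srt := fun i => some (s i)
      obtain ⟨ψ, hψ⟩ := hL.atom (τ := (pointedVocab τ F).extend (tupleSig s'))
        (.rel (Sum.inl (Sum.inl (FibreRel.rel r)))
          (consTerm s' fun i => AbstractLogic.argTerm s' i))
      refine ⟨ψ, fun N x => (hψ _).trans (iff_of_eq ?_)⟩
      exact congrArg (N.interp.rel (Sum.inl (FibreRel.rel r)))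
        (eval_consTerm s' N x fun i => AbstractLogic.argTerm s' i)
    · obtain ⟨t⟩ := r
      let s' : Fin 1 → (pointedVocab τ F).Srt := fun _ => some t
      obtain ⟨ψ, hψ⟩ := hL.atom (τ := (pointedVocab τ F).extend (tupleSig s'))
        (.eq (.app (Sum.inl (Sum.inl (FibreFunc.proj t))) fun _ => AbstractLogic.argTerm s' 0)
          (pointTerm s'))
      exact ⟨ψ, fun N x => hψ _⟩
  func := by
    rintro n s t (f | f)
    · let s' : Option (Fin n) → (pointedVocab τ F).Srt :=
        fun o => o.elim (some t) fun i => some (s i)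
      obtain ⟨ψ, hψ⟩ := hL.atom (τ := (pointedVocab τ F).extend (tupleSig s'))
        (.eq (.app (Sum.inl (Sum.inl (FibreFunc.func f)))
          (consTerm s' fun i => AbstractLogic.argTerm s' (some i)))
          (AbstractLogic.argTerm s' none))
      refine ⟨ψ, fun N x => (hψ _).trans (iff_of_eq ?_)⟩
      exact congrArg (fun z => N.interp.func (Sum.inl (FibreFunc.func f)) z = x none)
        (eval_consTerm s' N x fun i => AbstractLogic.argTerm s' (some i))
    · exact nomatch f
  const := by
    rintro t (c | c)
    · let s' : Unit → (pointedVocab τ F).Srt := fun _ => some t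
      obtain ⟨ψ, hψ⟩ := hL.atom (τ := (pointedVocab τ F).extend (tupleSig s'))
        (.eq (.app (Sum.inl (Sum.inl (FibreFunc.const c))) fun _ => pointTerm s')
          (AbstractLogic.argTerm s' ()))
      exact ⟨ψ, fun N x => hψ _⟩
    · exact nomatch c

/-- Satisfaction in the fibre over `x` is expressible. -/
theorem AbstractLogic.IsRegular.exists_fibre_sentence {L : AbstractLogic.{u, v}}
    (hL : L.IsRegular) (φ : L.Sentence τ) :
    ∃ ψ : L.Sentence (pointedVocab τ F), ∀ (N : Str (fibreVocab τ F)) (hN : N.IsFibred)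
      (x : Fin 1 → N.carrier none),
      L.Sat (N.withTuple (s := noneTuple τ F) x) ψ ↔ L.Sat (N.fibre hN (x 0)) φ := by
  -- Relativization cuts the structure `N.at x` down to the fibre; the translation then defines both
  -- inside `N` with its point.
  obtain ⟨φ', hφ'⟩ := hL.relativization φ
  obtain ⟨ψ, hψ⟩ := (fibreTranslation_isExpressible (F := F) hL).exists_sentence hL
    (Option.some_injective _) φ'
  refine ⟨ψ, fun N hN x => ?_⟩
  rw [hψ]
  exact hφ' (N.at (x 0)) (N.fibreSet (x 0)) (hN.isClosed (x 0))

/-! ### The family of structures as one structure -/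

/-- The disjoint union of the structures `A γ`. -/
noncomputable def totalStr {Γ : Type u} [hΓ : Nonempty Γ] (A : Γ → Str τ) (X : F → Set Γ) :
    Str (fibreVocab τ F) where
  carrier s := match s with
    | none => Γ
    | some s => Σ γ, (A γ).carrier s
  nonempty s := match s with
    | none => hΓ
    | some s => hΓ.elim fun γ => ((A γ).nonempty s).elim fun a => ⟨⟨γ, a⟩⟩
  interp :=
    { rel := fun r => match r with
        | .rel (s := s) r => fun z => ∃ y : ∀ i, (A (z 0)).carrier (s i),
            (∀ i, z (Fin.succ i) = ⟨z 0, y i⟩) ∧ (A (z 0)).interp.rel r y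
        | .family v => fun z => z 0 ∈ X v
      func := fun f => match f with
        -- Arguments outside the fibre over `z 0` get a default value inside it, since `IsFibred`
        -- constrains all arguments.
        | .func (s := s) (t := t) f => fun z => ⟨z 0, by
            classical
            exact if h : ∃ y : ∀ i, (A (z 0)).carrier (s i),
                ∀ i, z (Fin.succ i) = ⟨z 0, y i⟩ then
              (A (z 0)).interp.func f h.choose else ((A (z 0)).nonempty t).some⟩
        | .const c => fun z => ⟨z 0, (A (z 0)).interp.const c⟩
        | .proj t => fun z => (z 0).1
      const := fun c => nomatch c }

variable {Γ : Type u} [Nonempty Γ] (A : Γ → Str τ) (X : F → Set Γ)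

theorem totalStr_isFibred : (totalStr A X).IsFibred where
  func _ _ := rfl
  const _ _ := rfl
  surj t x := ⟨⟨x, ((A x).nonempty t).some⟩, rfl⟩

/-- The fibre over `γ` is `A γ`. -/
noncomputable def fibreTotalIso (γ : Γ) :
    Iso (A γ) ((totalStr A X).fibre (totalStr_isFibred A X) γ) where
  equiv s :=
    { toFun := fun a => ⟨⟨γ, a⟩, rfl⟩
      invFun := fun y => (show y.1.1 = γ from y.2) ▸ y.1.2
      left_inv := fun a => rfl
      right_inv := by
        rintro ⟨⟨γ', a⟩, h⟩
        obtain rfl : γ' = γ := h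
        rfl }
  map_rel {n s} r x := by
    constructor
    · intro h
      exact ⟨x, fun i => rfl, h⟩
    · rintro ⟨y, hy, h⟩
      have : x = y := funext fun i => eq_of_heq (Sigma.mk.inj (hy i)).2
      rw [this]
      exact h
  map_func {n s t} f x := by
    refine Subtype.ext ?_
    have h : ∃ y : ∀ i, (A γ).carrier (s i),
      ∀ i, (⟨γ, x i⟩ : Σ γ, (A γ).carrier (s i)) = ⟨γ, y i⟩ := ⟨x, fun i => rfl⟩
    have hy : h.choose = x := funext fun i => (eq_of_heq (Sigma.mk.inj (h.choose_spec i)).2).symm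
    refine congrArg (Sigma.mk γ) ?_
    refine Eq.trans ?_ (dif_pos h).symm
    exact congrArg ((A γ).interp.func f) hy.symm
  map_const c := rfl

/-- The first two conditions are equations, valid index by index. For surjectivity, a section of the
projection composed with an admissible function is admissible. -/
theorem power_isFibred (P : LimitUltrafilter.{u}) {N : Str (fibreVocab τ F)} (hN : N.IsFibred) :
    (P.power N).IsFibred where
  func {n s t} f z := by
    obtain ⟨g, rfl⟩ : ∃ g : ∀ i, P.LimitFun _, z = fun i => Quotient.mk (P.limitSetoid _) (g i) :=
      ⟨fun i => P.rep (z i), funext fun i => (Quotient.out_eq (s := P.limitSetoid _) (z i)).symm⟩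
    refine (congrArg (P.power N).proj (P.power_func N (FibreFunc.func f) g)).trans ?_
    refine (P.power_func N (FibreFunc.proj t) fun _ => _).trans ?_
    exact congrArg (Quotient.mk (P.limitSetoid _)) (Subtype.ext (funext fun j => hN.func f _))
  const {t} c x := by
    obtain ⟨g, rfl⟩ : ∃ g : ∀ i, P.LimitFun _, x = fun i => Quotient.mk (P.limitSetoid _) (g i) :=
      ⟨fun i => P.rep (x i), funext fun i => (Quotient.out_eq (s := P.limitSetoid _) (x i)).symm⟩
    refine (congrArg (P.power N).proj (P.power_func N (FibreFunc.const c) g)).trans ?_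
    refine (P.power_func N (FibreFunc.proj t) fun _ => _).trans ?_
    exact congrArg (Quotient.mk (P.limitSetoid _)) (Subtype.ext (funext fun j => hN.const c _))
  surj t x := by
    choose k hk using hN.surj t
    obtain ⟨g, rfl⟩ : ∃ g : P.LimitFun _, x = Quotient.mk (P.limitSetoid _) g :=
      ⟨P.rep x, (Quotient.out_eq (s := P.limitSetoid _) x).symm⟩
    refine ⟨Quotient.mk (P.limitSetoid _) (P.mapFun k g), ?_⟩
    refine (P.power_func N (FibreFunc.proj t) fun _ => _).trans ?_
    exact congrArg (Quotient.mk (P.limitSetoid _)) (Subtype.ext (funext fun j => hk _))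

end Fibre

/-- What holds in all fibres of `N`, or in those over points outside `v`, transfers as one statement
about points to the fibres of the limit ultrapower. -/
theorem AbstractLogic.isCompactRelTo_of_limitFamily {L : AbstractLogic.{u, v}}
    (hL : L.IsRegular) {lam : Cardinal.{u}} (hlam : ℵ₀ ≤ lam) {V : Set (Set (Base lam))}
    (hV : IsCofinalFamily Set.univ lam V)
    (h : ∀ nu : Cardinal.{u}, ℵ₀ ≤ nu →
      ∃ P : LimitUltrafilter.{u}, P.IsDecomposable lam ∧ (P, nu) ∈ L.limitFamily) :
    L.IsCompactRelTo lam V := by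
  intro τ T φ hT
  have := nonempty_base hlam
  choose A hA using hT
  let N : Str (fibreVocab τ V) := totalStr A fun v : V => v.1
  have hN : N.IsFibred := totalStr_isFibred A _
  obtain ⟨P, ⟨f, hfV, hfD⟩, hP⟩ := h (max ℵ₀ N.card) (le_max_left _ _)
  have hNP : L.Equivalent N (P.power N) := (hP _ N (le_max_right _ _)).equivalent
  have hPN := power_isFibred P hN
  -- The decomposing function is itself a point of the base of the limit ultrapower.
  let x : (P.power N).carrier none := Quotient.mk (P.limitSetoid (N.carrier none)) ⟨f, hfV⟩
  have hfib : ∀ γ χ, L.Sat (N.fibre hN γ) χ ↔ L.Sat (A γ) χ := fun γ χ =>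
    (L.sat_iso _ _ (fibreTotalIso A _ γ) χ).symm
  refine ⟨(P.power N).fibre hPN x, ?_⟩
  rintro χ (hχ | ⟨v, rfl⟩)
  · obtain ⟨ψ, hψ⟩ := hL.exists_fibre_sentence (F := V) χ
    refine (hψ _ hPN fun _ => x).1 (hNP.transfer hL (s := noneTuple τ V)
      (Q := fun N x => L.Sat (N.withTuple x) ψ) ⟨ψ, fun _ _ => Iff.rfl⟩ (fun y => ?_) _)
    exact (hψ N hN y).2 ((hfib _ _).2 (hA _ _ (Or.inl hχ)))
  · obtain ⟨ψ, hψ⟩ := hL.exists_fibre_sentence (F := V) (φ v)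
    have hQ : L.Expressible (noneTuple τ V) (fun N x =>
        ¬ N.interp.rel (s := noneTuple τ V) (FibreRel.family v) x → L.Sat (N.withTuple x) ψ) :=
      hL.expressible_imp (hL.expressible_not (hL.expressible_rel (τ := fibreVocab τ V)
        (s := noneTuple τ V) id (FibreRel.family v))) ⟨ψ, fun _ _ => Iff.rfl⟩
    refine (hψ _ hPN fun _ => x).1 (hNP.transfer hL hQ (fun y hy => ?_) _ fun hx => ?_)
    · exact (hψ N hN y).2 ((hfib _ _).2 (hA _ _ (Or.inr ⟨v, hy, rfl⟩)))
    -- If `x` satisfied the relation for `v`, the preimage of `v` under `f` would be in `D`,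
    -- although `#v < lam`.
    · exact hfD v.1 (hV.1 v.1 v.2).2
        ((P.power_rel N (FibreRel.family v) fun _ => ⟨f, hfV⟩).1 hx)

end ManySorted

theorem mainTheorem4 (L : ManySorted.AbstractLogic.{u, v}) (hL : L.IsRegular)
    (lam mu : Cardinal.{u}) (hmu : ℵ₀ ≤ mu) (hle : mu ≤ lam)
    (V₀ : Set (Set (ManySorted.Base lam)))
    (hV₀ : ManySorted.IsCofinalFamily Set.univ lam V₀)
    (V : Set (Set (ManySorted.Base lam)))
    (hV : ManySorted.IsCofinalFamily Set.univ lam V)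
    (W : Set (Set (ManySorted.Base lam)))
    (hW : ManySorted.IsCofinalFamily (ManySorted.below lam mu) mu W) :
    List.TFAE
      [L.IsCompactRelTo lam V₀,
       L.ExpansionsExtend lam mu (hmu.trans hle) V W,
       ∀ nu : Cardinal.{u}, ℵ₀ ≤ nu →
         ∃ P : ManySorted.LimitUltrafilter.{u}, P.IsDecomposable lam ∧ (P, nu) ∈ L.limitFamily] := by
  tfae_have 1 → 2 := fun h => h.expansionsExtend hL (hmu.trans hle) hV₀ hV
  tfae_have 2 → 3 := fun h nu _ => h.exists_limitUltrafilter hL (hmu.trans hle) hV nu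
  tfae_have 3 → 1 := fun h => ManySorted.AbstractLogic.isCompactRelTo_of_limitFamily hL
    (hmu.trans hle) hV₀ h
  tfae_finish
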